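/- Let $G$ be a finite connected plane graph (loops and multiple edges allowed, at least one edge) without leaves, i.e. without vertices of degree one. Let $\mathcal F$ be its set of bounded faces, $f_G=|\mathcal F|$, and let $e_G$ be its number of edges. For $S\subseteq\mathcal F$ let $e_S$ be the number of edges lying on the boundary of some face in $S$, and $f_S=|S|$; $S$ is called \emph{contractible} if $e_S-3f_S\le 0$. Assume that $e_G=3f_G$ and that no nonempty proper subset of $\mathcal F$ is contractible. An \emph{edge-injective function} $\varphi$ assigns to every $F\in\mathcal F$ a set $\varphi(F)$ of three edges on the boundary of $F$ such that $\varphi(F)\cap\varphi(F')=\emptyset$ for $F\ne F'$. Let $\Phi$ be the set of all edge-injective functions. The \emph{modified dual} $G^\star$ has vertex set $\mathcal F$; every edge of $G$ shared by two bounded faces gives an edge between them, and every edge of $G$ belonging to only one bounded face gives a loop there. Every $\varphi\in\Phi$ gives an orientation $G^\star_\varphi$ of $G^\star$ with in-degree three everywhere: $e$ is directed towards $F$ if $e\in\varphi(F)$. Draw $G^\star$ in the plane in the usual way, with the loops coming from edges on the unbounded face of $G$ drawn as small loops reaching into that face; apart from the regions enclosed by these small loops, the bounded faces of $G^\star$ correspond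 to the vertices of $G$ that are not on the unbounded face. A \emph{directed face cycle} of $G^\star_\varphi$ is the boundary walk of such a bounded face of $G^\star$, if it is directed in $G^\star_\varphi$ (the direction of a loop does not matter). Let $G_\Phi$ be the graph with vertex set $\Phi$ in which $\varphi\neq\varphi'$ are adjacent if $G^\star_\varphi$ and $G^\star_{\varphi'}$ differ exactly by reversing the arrows on a directed face cycle. Simple directed cycles are understood to have length at least two (loops are disregarded). Then: 1. For all $\varphi,\varphi'\in\Phi$, $G^\star_\varphi$ can be obtained from $G^\star_{\varphi'}$ by successively reversing simple directed cycles. 2. The graph $G_\Phi$ is connected (in particular $\Phi\neq\emptyset$); that is, any two elements of $\Phi$ are related by successively reversing directed face cycles. 3. For every $\varphi\in\Phi$, $|\Phi|=m+1$, where $m$ is the number of directed cycles of $G^\star_\varphi$; here a directed cycle is a nonempty edge set that is a union of pairwise edge-disjoint simple directed cycles. In particular $m$ does not depend on $\varphi$. -/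

import Mathlib

/-- A finite connected multigraph (loops and multiple edges are allowed, there is at least one
edge) embedded in the oriented plane, given by its rotation system. `D` is the type of darts, i.e.
of edges with a chosen direction; a dart leaves its tail vertex. `rev d` is the same edge with the
opposite direction, and `next d` is the dart that follows `d` in counterclockwise order around the
tail of `d`. Vertices, edges and faces are the cycles of `next`, `rev` and `next⁻¹ * rev`: walking
along `d` with a face on the left-hand side, one continues with `next⁻¹ (rev d)`.
Euler's formula `v - e + f = 2` says that the surface is the sphere, and the choice of an
unbounded face makes it the plane. -/
structure PlaneGraph (D : Type*) where
  next : Equiv.Perm D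
  rev : Equiv.Perm D
  rev_rev : ∀ d, rev (rev d) = d
  rev_ne : ∀ d, rev d ≠ d
  connected : ∀ a b : D, Relation.ReflTransGen (fun x y => y = next x ∨ y = rev x) a b
  euler : Nat.card (Quotient (Equiv.Perm.SameCycle.setoid next)) +
      Nat.card (Quotient (Equiv.Perm.SameCycle.setoid (next⁻¹ * rev))) =
    Nat.card (Quotient (Equiv.Perm.SameCycle.setoid rev)) + 2
  /-- the unbounded face -/
  outer : Quotient (Equiv.Perm.SameCycle.setoid (next⁻¹ * rev))

namespace PlaneGraph

variable {D : Type*} (G : PlaneGraph D)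

/-- The vertices of the graph. -/
abbrev Vertex : Type _ := Quotient (Equiv.Perm.SameCycle.setoid G.next)

/-- The edges of the graph. -/
abbrev Edge : Type _ := Quotient (Equiv.Perm.SameCycle.setoid G.rev)

/-- All faces of the plane graph, including the unbounded one. -/
abbrev Face : Type _ := Quotient (Equiv.Perm.SameCycle.setoid (G.next⁻¹ * G.rev))

/-- The vertex from which a dart leaves. -/
def tail (d : D) : G.Vertex := Quotient.mk _ d

/-- The edge underlying a dart. -/
def edge (d : D) : G.Edge := Quotient.mk _ d

/-- The face to the left of a dart. -/
def left (d : D) : G.Face := Quotient.mk _ d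

/-- The face to the right of a dart. -/
def right (d : D) : G.Face := G.left (G.rev d)

/-- The bounded faces. -/
abbrev BoundedFace : Type _ := {F : G.Face // F ≠ G.outer}

/-- There are no leaves: no vertex has degree one. -/
def NoLeaves : Prop := ∀ d : D, G.next d ≠ d

/-- The edge `e` lies on the boundary of the face `F`. -/
def OnFace (e : G.Edge) (F : G.Face) : Prop := ∃ d : D, G.edge d = e ∧ G.left d = F

/-- The edges of the subgraph formed by the faces in `S` with their bounding vertices and edges. -/
def edgesOf (S : Set G.BoundedFace) : Set G.Edge := {e | ∃ F ∈ S, G.OnFace e F.1}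

/-- A set `S` of bounded faces is contractible if `e_S - 3 f_S ≤ 0`. -/
def Contractible (S : Set G.BoundedFace) : Prop :=
  ((G.edgesOf S).ncard : ℤ) - 3 * (S.ncard : ℤ) ≤ 0

/-- No proper (nonempty) subset of the set of bounded faces is contractible. -/
def NoProperContractible : Prop :=
  ∀ S : Set G.BoundedFace, S.Nonempty → S ≠ Set.univ → ¬ G.Contractible S

/-- The edge-injective functions: each bounded face gets a triple of edges on its boundary, and
different faces get disjoint triples. -/
abbrev EdgeInjective : Type _ :=
  {φ : G.BoundedFace → Finset G.Edge //
    (∀ F, (φ F).card = 3) ∧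
    (∀ F, ∀ e ∈ φ F, G.OnFace e F.1) ∧
    (∀ F F', F ≠ F' → Disjoint (φ F) (φ F'))}

/-- Incidence in the modified dual graph `G*`: its vertices are the bounded faces, an edge shared by
two bounded faces joins them, and an edge that belongs to only one bounded face is a loop there. -/
def DualJoins (e : G.Edge) (F F' : G.BoundedFace) : Prop :=
  (F ≠ F' ∧ G.OnFace e F.1 ∧ G.OnFace e F'.1) ∨
  (F = F' ∧ G.OnFace e F.1 ∧ ∀ F'' : G.BoundedFace, G.OnFace e F''.1 → F'' = F)

variable {G}

/-- In the orientation `G*_φ` of the modified dual, the edge `e` is directed from `F` to `F'`. -/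
def Arrow (φ : G.EdgeInjective) (e : G.Edge) (F F' : G.BoundedFace) : Prop :=
  G.DualJoins e F F' ∧ e ∈ φ.1 F'

/-- `C` is the edge set of a simple directed cycle of `G*_φ` of length at least two (reversing a
loop has no effect, so that loops are disregarded). -/
def IsDirectedCycle (φ : G.EdgeInjective) (C : Set G.Edge) : Prop :=
  ∃ (n : ℕ) (F : Fin (n + 2) → G.BoundedFace) (e : Fin (n + 2) → G.Edge),
    Function.Injective F ∧ (∀ i, Arrow φ (e i) (F i) (F (i + 1))) ∧ C = Set.range e

/-- `C` is the edge set of a nonempty union of pairwise edge-disjoint simple directed cycles of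
`G*_φ`; this includes the simple directed cycles themselves. -/
def IsGenDirectedCycle (φ : G.EdgeInjective) (C : Set G.Edge) : Prop :=
  ∃ 𝒞 : Set (Set G.Edge), 𝒞.Nonempty ∧ (∀ c ∈ 𝒞, IsDirectedCycle φ c) ∧
    𝒞.PairwiseDisjoint id ∧ C = ⋃₀ 𝒞

/-- `G*_ψ` arises from `G*_φ` by reversing exactly the arrows on the edges in `C`. -/
def Reverses (C : Set G.Edge) (φ ψ : G.EdgeInjective) : Prop :=
  (∀ e ∉ C, ∀ F F', Arrow φ e F F' ↔ Arrow ψ e F F') ∧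
  (∀ e ∈ C, ∀ F F', Arrow φ e F F' ↔ Arrow ψ e F' F)

/-- The vertex `v` is not on the unbounded face. These vertices correspond to the bounded faces of
the plane graph `G*` (apart from those enclosed by the small loops at the outer edges). -/
def Interior (v : G.Vertex) : Prop := ∀ d : D, G.tail d = v → G.left d ≠ G.outer

/-- `e` is directed from the face `F` to the face `F'` in `G*_φ`, for faces `F`, `F'` of the plane
graph, which then are bounded. -/
def FaceArrow (φ : G.EdgeInjective) (e : G.Edge) (F F' : G.Face) : Prop :=
  ∃ (hF : F ≠ G.outer) (hF' : F' ≠ G.outer), Arrow φ e ⟨F, hF⟩ ⟨F', hF'⟩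

/-- `v` is an interior vertex and the boundary walk of the face of `G*` around `v` is directed in
`G*_φ`. Going counterclockwise around `v`, this walk crosses each edge `d` leaving `v` from its
right to its left; it is directed if all of its arrows point in that sense, or all in the opposite
sense. -/
def IsDirectedFaceCycle (φ : G.EdgeInjective) (v : G.Vertex) : Prop :=
  Interior v ∧
    ((∀ d : D, G.tail d = v → FaceArrow φ (G.edge d) (G.right d) (G.left d)) ∨
     (∀ d : D, G.tail d = v → FaceArrow φ (G.edge d) (G.left d) (G.right d)))

/-- The edges on the boundary of the face of `G*` around the vertex `v`. -/
def faceCycle (v : G.Vertex) : Set G.Edge := {e | ∃ d : D, G.tail d = v ∧ G.edge d = e}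

variable (G)

/-- The graph `G_Φ` on the set `Φ` of edge-injective functions: two different ones are adjacent if
their orientations of `G*` differ by reversing a directed face cycle. -/
def flipGraph : SimpleGraph G.EdgeInjective :=
  SimpleGraph.fromRel fun φ ψ =>
    ∃ v : G.Vertex, IsDirectedFaceCycle φ v ∧ Reverses (faceCycle v) φ ψ

end PlaneGraph

/-!
With a vertex added for the unbounded face, an edge-injective function `φ` orients the whole dual
graph of `G`. Hall's theorem provides such a `φ`. Two orientations have the same in-degrees if and
only if they differ by reversing a balanced set of edges, i.e. one that enters and leaves each face
equally often, and the balanced sets are the unions of disjoint directed cycles. So reversal is a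
bijection from the generalized directed cycles of `φ` to the other edge-injective functions, and it
can be carried out one cycle at a time.

By Euler's formula, the difference of two such orientations is the coboundary of an integer height
function on the vertices of `G` that is zero on the boundary of the unbounded face. Suppose that it
has positive values, but the face cycle at no vertex of maximal height is clockwise. Walking along
darts that are crossed from right to left, one stays at maximal height, so there is a cycle of such
darts in `G`. No edge leaves the set of bounded faces around which this cycle winds most often, so
this set is contractible. This contradiction gives a clockwise face cycle at a vertex of positive
height, and reversing it lowers the height there by one.
-/

/-- A directed multigraph with vertex type `V` and edge type `E`; loops and parallel edges are
allowed. -/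
@[ext]
structure DirectedMultigraph (V E : Type*) where
  /-- the vertex at which an edge starts -/
  src : E → V
  /-- the vertex at which an edge ends -/
  tgt : E → V

namespace DirectedMultigraph

variable {V E : Type*} (Γ : DirectedMultigraph V E)

/-- `C` is the edge set of a simple directed cycle. A loop is a cycle of length one. -/
def IsCycle (C : Set E) : Prop :=
  ∃ (n : ℕ) (x : Fin (n + 1) → V) (e : Fin (n + 1) → E), Function.Injective x ∧
    (∀ i, Γ.src (e i) = x i ∧ Γ.tgt (e i) = x (i + 1)) ∧ C = Set.range e

/-- A set of edges is balanced if it enters and leaves every vertex equally often. -/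
def IsBalanced (C : Set E) : Prop :=
  ∀ v, {e ∈ C | Γ.tgt e = v}.ncard = {e ∈ C | Γ.src e = v}.ncard

open Classical in
/-- The directed multigraph obtained by reversing the edges in `C`. -/
noncomputable def reverse (C : Set E) : DirectedMultigraph V E where
  src e := if e ∈ C then Γ.tgt e else Γ.src e
  tgt e := if e ∈ C then Γ.src e else Γ.tgt e

variable {Γ}

theorem reverse_src_of_mem {C : Set E} {e : E} (he : e ∈ C) : (Γ.reverse C).src e = Γ.tgt e :=
  if_pos he

theorem reverse_tgt_of_mem {C : Set E} {e : E} (he : e ∈ C) : (Γ.reverse C).tgt e = Γ.src e :=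
  if_pos he

theorem reverse_src_of_notMem {C : Set E} {e : E} (he : e ∉ C) :
    (Γ.reverse C).src e = Γ.src e :=
  if_neg he

theorem reverse_tgt_of_notMem {C : Set E} {e : E} (he : e ∉ C) :
    (Γ.reverse C).tgt e = Γ.tgt e :=
  if_neg he

theorem IsCycle.nonempty {C : Set E} (hC : Γ.IsCycle C) : C.Nonempty := by
  obtain ⟨n, x, e, -, -, rfl⟩ := hC
  exact Set.range_nonempty e

theorem isBalanced_range {ι : Type*} {e : ι → E} (he : Function.Injective e)
    (σ : Equiv.Perm ι) (h : ∀ i, Γ.src (e (σ i)) = Γ.tgt (e i)) :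
    Γ.IsBalanced (Set.range e) := by
  intro v
  have image_eq (u : E → V) : {a ∈ Set.range e | u a = v} = e '' {i | u (e i) = v} := by
    ext a
    constructor
    · rintro ⟨⟨i, rfl⟩, hi⟩
      exact ⟨i, hi, rfl⟩
    · rintro ⟨i, hi, rfl⟩
      exact ⟨⟨i, rfl⟩, hi⟩
  have preimage_eq : {i | Γ.tgt (e i) = v} = σ ⁻¹' {i | Γ.src (e i) = v} := by
    ext i
    simp only [Set.mem_preimage, Set.mem_ofPred_eq, h]
  rw [image_eq, image_eq, Set.ncard_image_of_injective _ he, Set.ncard_image_of_injective _ he,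
    preimage_eq, Set.ncard_preimage_of_injective_subset_range σ.injective
      (by simp only [σ.surjective.range_eq, Set.subset_univ])]

theorem IsCycle.isBalanced {C : Set E} (hC : Γ.IsCycle C) : Γ.IsBalanced C := by
  obtain ⟨n, x, e, hx, he, rfl⟩ := hC
  have he_inj : Function.Injective e := fun i j hij =>
    hx (by rw [← (he i).1, ← (he j).1, hij])
  exact isBalanced_range he_inj (Equiv.addRight 1) fun i =>
    (he (i + 1)).1.trans (he i).2.symm

theorem IsCycle.finsum_mem_src_eq {M : Type*} [AddCommMonoid M] {C : Set E} (hC : Γ.IsCycle C)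
    (f : V → M) : ∑ᶠ e ∈ C, f (Γ.src e) = ∑ᶠ e ∈ C, f (Γ.tgt e) := by
  obtain ⟨n, x, e, hx, he, rfl⟩ := hC
  have he_inj : Function.Injective e := fun i j hij =>
    hx (by rw [← (he i).1, ← (he j).1, hij])
  rw [finsum_mem_range he_inj, finsum_mem_range he_inj, finsum_eq_sum_of_fintype,
    finsum_eq_sum_of_fintype, ← Equiv.sum_comp (Equiv.addRight (1 : Fin (n + 1)))]
  exact Finset.sum_congr rfl fun i _ => by
    rw [Equiv.coe_addRight, (he (i + 1)).1, (he i).2]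

theorem exists_mem_periodicPts {α : Type*} [Finite α] [Nonempty α] (f : α → α) :
    ∃ a, a ∈ Function.periodicPts f := by
  obtain ⟨m, n, hmn, h⟩ :=
    Finite.exists_ne_map_eq_of_infinite fun n : ℕ => f^[n] (Classical.arbitrary α)
  wlog hlt : m < n generalizing m n
  · exact this n m hmn.symm h.symm (by omega)
  refine ⟨f^[m] (Classical.arbitrary α), Function.mk_mem_periodicPts (n := n - m) (by omega) ?_⟩
  rw [Function.IsPeriodicPt, Function.IsFixedPt, ← Function.iterate_add_apply,
    Nat.sub_add_cancel hlt.le]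
  exact h.symm

theorem exists_isCycle_subset [Finite V] {C : Set E} (hne : C.Nonempty)
    (hsucc : ∀ e ∈ C, ∃ e' ∈ C, Γ.src e' = Γ.tgt e) : ∃ c ⊆ C, Γ.IsCycle c := by
  -- A function choosing an outgoing edge of `C` at each source of `C` has a periodic orbit.
  let U : Set V := Γ.src '' C
  choose out hout hsrc using fun v : U => v.2
  let f : U → U := fun v => ⟨Γ.tgt (out v), hsucc _ (hout v)⟩
  have : Nonempty U := (hne.image Γ.src).to_subtype
  obtain ⟨a, ha⟩ := exists_mem_periodicPts f
  obtain ⟨n, hn⟩ : ∃ n, Function.minimalPeriod f a = n + 1 :=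
    Nat.exists_eq_add_one.2 (Function.minimalPeriod_pos_of_mem_periodicPts ha)
  refine ⟨Set.range fun i : Fin (n + 1) => out (f^[i] a), ?_, n, fun i => (f^[i] a : U), _, ?_,
    fun i => ⟨hsrc _, ?_⟩, rfl⟩
  · rintro - ⟨i, rfl⟩
    exact hout _
  · intro i j hij
    refine Fin.ext (Function.iterate_injOn_Iio_minimalPeriod (f := f) (x := a) ?_ ?_
      (Subtype.ext hij))
    all_goals simp only [hn, Set.mem_Iio, Fin.is_lt]
  · have hval : ((i + 1 : Fin (n + 1)) : ℕ) = (i + 1) % Function.minimalPeriod f a := by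
      rw [hn, Fin.val_add, Fin.val_one', Nat.add_mod_mod]
    simp only [hval]
    rw [Function.iterate_mod_minimalPeriod_eq, Function.iterate_succ_apply']

section Balanced

variable [Finite E] {C C' : Set E}

theorem IsBalanced.exists_src_eq (hC : Γ.IsBalanced C) {e : E} (he : e ∈ C) :
    ∃ e' ∈ C, Γ.src e' = Γ.tgt e := by
  have hpos : 0 < {a ∈ C | Γ.src a = Γ.tgt e}.ncard := by
    rw [← hC, Set.ncard_pos]
    exact ⟨e, he, rfl⟩
  exact (Set.ncard_pos (Set.toFinite _)).1 hpos

theorem IsBalanced.sdiff (hC : Γ.IsBalanced C) (hC' : Γ.IsBalanced C') (hsub : C' ⊆ C) :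
    Γ.IsBalanced (C \ C') := by
  intro v
  have ncard_eq (u : E → V) : {e ∈ C \ C' | u e = v}.ncard =
      {e ∈ C | u e = v}.ncard - {e ∈ C' | u e = v}.ncard := by
    have hsub' : {e ∈ C' | u e = v} ⊆ {e ∈ C | u e = v} := fun e he => ⟨hsub he.1, he.2⟩
    rw [← Set.ncard_sdiff hsub']
    congr 1
    ext e
    simp only [Set.mem_ofPred_eq, Set.mem_sdiff]
    tauto
  rw [ncard_eq, ncard_eq, hC, hC']

theorem IsBalanced.sUnion {𝒞 : Set (Set E)} (h𝒞 : ∀ c ∈ 𝒞, Γ.IsBalanced c)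
    (hdisj : 𝒞.PairwiseDisjoint id) : Γ.IsBalanced (⋃₀ 𝒞) := by
  intro v
  have ncard_eq (u : E → V) :
      {e ∈ ⋃₀ 𝒞 | u e = v}.ncard = ∑ᶠ c ∈ 𝒞, {e ∈ c | u e = v}.ncard := by
    rw [← Set.Finite.ncard_biUnion 𝒞.toFinite (fun _ _ => Set.toFinite _)
      fun c hc c' hc' hne => (hdisj hc hc' hne).mono (fun _ h => h.1) (fun _ h => h.1)]
    congr 1
    ext e
    simp only [Set.mem_ofPred_eq, Set.mem_sUnion, Set.mem_iUnion, exists_prop]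
    tauto
  rw [ncard_eq, ncard_eq]
  exact finsum_mem_congr rfl fun c hc => h𝒞 c hc v

theorem IsBalanced.exists_eq_sUnion_isCycle [Finite V] (hC : Γ.IsBalanced C) :
    ∃ 𝒞 : Set (Set E), (∀ c ∈ 𝒞, Γ.IsCycle c) ∧ 𝒞.PairwiseDisjoint id ∧ C = ⋃₀ 𝒞 := by
  induction hn : C.ncard using Nat.strong_induction_on generalizing C with
  | h n ih =>
    obtain rfl | hne := C.eq_empty_or_nonempty
    · exact ⟨∅, by simp⟩
    obtain ⟨c, hcC, hc⟩ := exists_isCycle_subset hne fun _ => hC.exists_src_eq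
    have hlt : (C \ c).ncard < n := by
      have hpos : 0 < c.ncard := (Set.ncard_pos c.toFinite).2 hc.nonempty
      have := Set.ncard_sdiff_add_ncard_of_subset hcC
      omega
    obtain ⟨𝒞, h𝒞, hdisj, heq⟩ := ih _ hlt (hC.sdiff hc.isBalanced hcC) rfl
    refine ⟨insert c 𝒞, Set.forall_mem_insert.2 ⟨hc, h𝒞⟩,
      hdisj.insert fun d hd _ => ?_, ?_⟩
    · exact Set.disjoint_sdiff_right.mono_right (heq ▸ Set.subset_sUnion_of_mem hd)
    · rw [Set.sUnion_insert, ← heq, Set.union_sdiff_cancel hcC]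

theorem isBalanced_iff_ncard_reverse_tgt :
    Γ.IsBalanced C ↔
      ∀ v, {e | (Γ.reverse C).tgt e = v}.ncard = {e | Γ.tgt e = v}.ncard := by
  have split (A : Set E) : A.ncard = (A ∩ C).ncard + (A \ C).ncard :=
    (Set.ncard_inter_add_ncard_sdiff_eq_ncard A C).symm
  refine forall_congr' fun v => ?_
  have hmem : {e | (Γ.reverse C).tgt e = v} ∩ C = {e ∈ C | Γ.src e = v} :=
    Set.ext fun e => and_comm.trans <| and_congr_right fun he => by
      rw [Set.mem_ofPred_eq, reverse_tgt_of_mem he]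
  have hnotMem : {e | (Γ.reverse C).tgt e = v} \ C = {e | Γ.tgt e = v} \ C :=
    Set.ext fun e => and_congr_left fun he => by
      rw [Set.mem_ofPred_eq, Set.mem_ofPred_eq, reverse_tgt_of_notMem he]
  have hmem' : {e | Γ.tgt e = v} ∩ C = {e ∈ C | Γ.tgt e = v} :=
    Set.ext fun e => and_comm
  rw [split {e | (Γ.reverse C).tgt e = v}, split {e | Γ.tgt e = v}, hmem, hnotMem, hmem']
  omega

end Balanced

end DirectedMultigraph

namespace PlaneGraph

open scoped Matrix

variable {D : Type*} (G : PlaneGraph D)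

/-- The vertex at which a dart arrives. -/
def head (d : D) : G.Vertex := G.tail (G.rev d)

variable {G}

theorem tail_surjective : Function.Surjective G.tail := Quotient.mk_surjective

theorem left_surjective : Function.Surjective G.left := Quotient.mk_surjective

theorem edge_surjective : Function.Surjective G.edge := Quotient.mk_surjective

theorem tail_next (d : D) : G.tail (G.next d) = G.tail d :=
  Quotient.sound (Equiv.Perm.SameCycle.symm ⟨1, by rw [zpow_one]⟩)

theorem tail_next_symm (d : D) : G.tail (G.next.symm d) = G.tail d := by
  rw [← tail_next, Equiv.apply_symm_apply]

theorem head_rev (d : D) : G.head (G.rev d) = G.tail d := by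
  rw [head, G.rev_rev]

theorem tail_rev (d : D) : G.tail (G.rev d) = G.head d := rfl

theorem edge_rev (d : D) : G.edge (G.rev d) = G.edge d :=
  Quotient.sound (Equiv.Perm.SameCycle.symm ⟨1, by rw [zpow_one]⟩)

theorem right_rev (d : D) : G.right (G.rev d) = G.left d := by
  rw [right, G.rev_rev]

theorem left_rev (d : D) : G.left (G.rev d) = G.right d := rfl

theorem left_next_symm (d : D) : G.left (G.next.symm d) = G.right d := by
  have h : G.left (G.next.symm (G.rev (G.rev d))) = G.left (G.rev d) :=
    Quotient.sound (Equiv.Perm.SameCycle.symm ⟨1, by rw [zpow_one]; rfl⟩)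
  rwa [G.rev_rev] at h

theorem right_next (d : D) : G.right (G.next d) = G.left d := by
  rw [← left_next_symm, Equiv.symm_apply_apply]

theorem edge_eq_iff {d d' : D} : G.edge d = G.edge d' ↔ d = d' ∨ d = G.rev d' := by
  constructor
  · intro h
    obtain ⟨i, hi⟩ : Equiv.Perm.SameCycle G.rev d d' := Quotient.exact h
    have hsq : G.rev ^ (2 : ℤ) = 1 := by
      ext x
      rw [zpow_ofNat, pow_two]
      exact G.rev_rev x
    obtain ⟨k, rfl | rfl⟩ := Int.even_or_odd' i
    · left
      rwa [zpow_mul, hsq, one_zpow, Equiv.Perm.one_apply] at hi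
    · right
      rw [zpow_add, zpow_mul, hsq, one_zpow, one_mul, zpow_one] at hi
      rw [← hi, G.rev_rev]
  · rintro (rfl | rfl)
    · rfl
    · exact edge_rev d'

theorem onFace_edge_iff {d : D} {F : G.Face} :
    G.OnFace (G.edge d) F ↔ F = G.left d ∨ F = G.right d := by
  constructor
  · rintro ⟨d', hd', rfl⟩
    obtain rfl | rfl := edge_eq_iff.1 hd'
    · exact Or.inl rfl
    · exact Or.inr rfl
  · rintro (rfl | rfl)
    · exact ⟨d, rfl, rfl⟩
    · exact ⟨G.rev d, edge_rev d, rfl⟩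

theorem sum_edge [Fintype D] [Fintype G.Edge] {M : Type*} [AddCommMonoid M] (f : G.Edge → M) :
    ∑ d, f (G.edge d) = 2 • ∑ e, f e := by
  classical
  rw [← Finset.sum_fiberwise' Finset.univ G.edge, Finset.smul_sum]
  refine Finset.sum_congr rfl fun e _ => ?_
  obtain ⟨d, rfl⟩ := edge_surjective e
  have fiber_eq : ({d' | G.edge d' = G.edge d} : Finset D) = {d, G.rev d} := by
    ext d'
    simp only [Finset.mem_filter, Finset.mem_univ, true_and, edge_eq_iff, Finset.mem_insert,
      Finset.mem_singleton]
  rw [Finset.sum_const, fiber_eq, Finset.card_pair (G.rev_ne d).symm]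

theorem eq_of_dart_invariant {α : Type*} {f : D → α} (hnext : ∀ d, f (G.next d) = f d)
    (hrev : ∀ d, f (G.rev d) = f d) (a b : D) : f a = f b := by
  induction G.connected a b with
  | refl => rfl
  | tail _ hs ih =>
    obtain rfl | rfl := hs
    · rw [ih, hnext]
    · rw [ih, hrev]

theorem eq_of_head_eq_tail {α : Type*} {p : G.Vertex → α}
    (h : ∀ d, p (G.head d) = p (G.tail d)) (v w : G.Vertex) : p v = p w := by
  obtain ⟨a, rfl⟩ := tail_surjective v
  obtain ⟨b, rfl⟩ := tail_surjective w
  exact eq_of_dart_invariant (f := fun d => p (G.tail d)) (fun d => by rw [tail_next]) h a b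

theorem eq_of_left_eq_right {α : Type*} {g : G.Face → α}
    (h : ∀ d, g (G.left d) = g (G.right d)) (F F' : G.Face) : g F = g F' := by
  obtain ⟨a, rfl⟩ := left_surjective F
  obtain ⟨b, rfl⟩ := left_surjective F'
  exact eq_of_dart_invariant (f := fun d => g (G.left d)) (fun d => by rw [h, right_next])
    (fun d => (h d).symm) a b

theorem tail_eq_of_forall_left_eq [Finite D] {α : Type*} {p : G.Vertex → α} {F : G.Face}
    (h : ∀ d, G.left d = F → p (G.head d) = p (G.tail d)) {a b : D}
    (ha : G.left a = F) (hb : G.left b = F) : p (G.tail a) = p (G.tail b) := by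
  obtain ⟨k, rfl⟩ := Equiv.Perm.SameCycle.exists_nat_pow_eq
    (Quotient.exact (ha.trans hb.symm) : Equiv.Perm.SameCycle (G.next⁻¹ * G.rev) a b)
  have left_walk (k : ℕ) : G.left (((G.next⁻¹ * G.rev) ^ k) a) = F :=
    ha ▸ Quotient.sound (Equiv.Perm.SameCycle.symm ⟨k, rfl⟩)
  clear hb
  induction k with
  | zero => rfl
  | succ k ih =>
    rw [ih, ← h _ (left_walk k), pow_succ', Equiv.Perm.mul_apply]
    exact congrArg p (tail_next_symm _).symm

/-! ### The discrete Hodge decomposition on the sphere -/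

section Hodge

variable {K : Type*} [Field K]

variable (G K) in
/-- The coboundary operator of the primal graph: the increments of a function on the vertices
along the darts. -/
def vertexCoboundary : (G.Vertex → K) →ₗ[K] (D → K) :=
  LinearMap.funLeft K K G.head - LinearMap.funLeft K K G.tail

variable (G K) in
/-- The coboundary operator of the dual graph: the increments of a function on the faces when
crossing the darts from right to left. -/
def faceCoboundary : (G.Face → K) →ₗ[K] (D → K) :=
  LinearMap.funLeft K K G.left - LinearMap.funLeft K K G.right

variable (G K) in
/-- The space of functions on darts that change sign when the dart is reversed. -/
def antisymmetric : Submodule K (D → K) where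
  carrier := {c | ∀ d, c (G.rev d) = -c d}
  add_mem' hb hc d := by rw [Pi.add_apply, Pi.add_apply, hb d, hc d, neg_add]
  zero_mem' _ := neg_zero.symm
  smul_mem' r c hc d := by rw [Pi.smul_apply, Pi.smul_apply, hc d, smul_neg]

theorem vertexCoboundary_apply (p : G.Vertex → K) (d : D) :
    G.vertexCoboundary K p d = p (G.head d) - p (G.tail d) := rfl

theorem faceCoboundary_apply (g : G.Face → K) (d : D) :
    G.faceCoboundary K g d = g (G.left d) - g (G.right d) := rfl

theorem vertexCoboundary_mem_antisymmetric (p : G.Vertex → K) :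
    G.vertexCoboundary K p ∈ G.antisymmetric K := fun d => by
  rw [vertexCoboundary_apply, vertexCoboundary_apply, head_rev, tail_rev, neg_sub]

theorem faceCoboundary_mem_antisymmetric (g : G.Face → K) :
    G.faceCoboundary K g ∈ G.antisymmetric K := fun d => by
  rw [faceCoboundary_apply, faceCoboundary_apply, right_rev, left_rev, neg_sub]

theorem finrank_antisymmetric_le [Finite D] :
    Module.finrank K (G.antisymmetric K) ≤ Nat.card G.Edge := by
  have := Fintype.ofFinite G.Edge
  let restrict : G.antisymmetric K →ₗ[K] (G.Edge → K) :=
    LinearMap.funLeft K K Quotient.out ∘ₗ (G.antisymmetric K).subtype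
  have hinj : Function.Injective restrict := by
    rw [← LinearMap.ker_eq_bot, LinearMap.ker_eq_bot']
    intro c hc
    ext d
    have hout : c.1 (G.edge d).out = 0 := congrFun hc (G.edge d)
    obtain h | h := edge_eq_iff.1 (Quotient.out_eq (G.edge d) : G.edge (G.edge d).out = G.edge d)
    · rwa [h] at hout
    · rwa [h, c.2 d, neg_eq_zero] at hout
  simpa only [Module.finrank_fintype_fun_eq_card, Nat.card_eq_fintype_card] using
    LinearMap.finrank_le_finrank_of_injective hinj

theorem card_le_finrank_range_add_one {ι M : Type*} [Finite ι] [AddCommGroup M] [Module K M]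
    {f : (ι → K) →ₗ[K] M} (h : ∀ p, f p = 0 → ∀ i j, p i = p j) :
    Nat.card ι ≤ Module.finrank K (LinearMap.range f) + 1 := by
  have := Fintype.ofFinite ι
  have hker : LinearMap.ker f ≤ K ∙ (1 : ι → K) := by
    intro p hp
    cases isEmpty_or_nonempty ι
    · rw [Subsingleton.elim p 0]
      exact zero_mem _
    · refine Submodule.mem_span_singleton.2 ⟨p (Classical.arbitrary ι), funext fun i => ?_⟩
      rw [Pi.smul_apply, Pi.one_apply, smul_eq_mul, mul_one, h p hp i]
  have hrank := LinearMap.finrank_range_add_finrank_ker f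
  have hle := (Submodule.finrank_mono hker).trans (finrank_span_le_card _)
  rw [Module.finrank_fintype_fun_eq_card, ← Nat.card_eq_fintype_card] at hrank
  rw [Set.toFinset_singleton, Finset.card_singleton] at hle
  omega

variable [Fintype D]

theorem comp_rev_dotProduct {c : D → K} (hc : c ∈ G.antisymmetric K) (u : D → K) :
    (u ∘ G.rev) ⬝ᵥ c = -(u ⬝ᵥ c) := by
  rw [← comp_equiv_dotProduct_comp_equiv u c G.rev, ← dotProduct_neg]
  congr 1
  ext d
  rw [Pi.neg_apply, Function.comp_apply, hc d, neg_neg]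

theorem vertexCoboundary_dotProduct {c : D → K} (hc : c ∈ G.antisymmetric K) (p : G.Vertex → K) :
    G.vertexCoboundary K p ⬝ᵥ c = -2 * ((p ∘ G.tail) ⬝ᵥ c) := by
  have h : G.vertexCoboundary K p = (p ∘ G.tail) ∘ G.rev - p ∘ G.tail := rfl
  rw [h, sub_dotProduct, comp_rev_dotProduct hc]
  ring

theorem faceCoboundary_dotProduct {c : D → K} (hc : c ∈ G.antisymmetric K) (g : G.Face → K) :
    G.faceCoboundary K g ⬝ᵥ c = 2 * ((g ∘ G.left) ⬝ᵥ c) := by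
  have h : G.faceCoboundary K g = g ∘ G.left - (g ∘ G.left) ∘ G.rev := rfl
  rw [h, sub_dotProduct, comp_rev_dotProduct hc]
  ring

theorem vertexCoboundary_dotProduct_faceCoboundary (p : G.Vertex → K) (g : G.Face → K) :
    G.vertexCoboundary K p ⬝ᵥ G.faceCoboundary K g = 0 := by
  have htail : (p ∘ G.tail) ∘ G.next = p ∘ G.tail :=
    funext fun d => congrArg p (tail_next d)
  have hright : (g ∘ G.right) ∘ G.next = g ∘ G.left :=
    funext fun d => congrArg g (right_next d)
  have hsub : G.faceCoboundary K g = g ∘ G.left - g ∘ G.right := rfl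
  rw [vertexCoboundary_dotProduct (faceCoboundary_mem_antisymmetric g), hsub, dotProduct_sub,
    ← comp_equiv_dotProduct_comp_equiv _ (g ∘ G.right) G.next, htail, hright, sub_self, mul_zero]

variable [LinearOrder K] [IsStrictOrderedRing K]

omit [Fintype D] in
/-- Euler's formula leaves no room for harmonic functions. -/
theorem exists_eq_vertexCoboundary_add_faceCoboundary [Finite D] {c : D → K}
    (hc : c ∈ G.antisymmetric K) :
    ∃ p g, c = G.vertexCoboundary K p + G.faceCoboundary K g := by
  have := Fintype.ofFinite D
  let P := LinearMap.range (G.vertexCoboundary K)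
  let Q := LinearMap.range (G.faceCoboundary K)
  have hinf : P ⊓ Q = ⊥ := by
    rw [eq_bot_iff]
    rintro x ⟨⟨p, hp⟩, g, hg⟩
    have horth := vertexCoboundary_dotProduct_faceCoboundary p g
    rw [hp, hg] at horth
    exact (Submodule.mem_bot K).2 (dotProduct_self_eq_zero.1 horth)
  have hsup : P ⊔ Q ≤ G.antisymmetric K := by
    rw [sup_le_iff]
    constructor
    · rintro _ ⟨p, rfl⟩
      exact vertexCoboundary_mem_antisymmetric p
    · rintro _ ⟨g, rfl⟩
      exact faceCoboundary_mem_antisymmetric g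
  have hrank := Submodule.finrank_sup_add_finrank_inf_eq P Q
  rw [hinf, finrank_bot] at hrank
  have hP : Nat.card G.Vertex ≤ Module.finrank K P + 1 :=
    card_le_finrank_range_add_one fun p hp =>
      eq_of_head_eq_tail fun d => sub_eq_zero.1 (congrFun hp d)
  have hQ : Nat.card G.Face ≤ Module.finrank K Q + 1 :=
    card_le_finrank_range_add_one fun g hg =>
      eq_of_left_eq_right fun d => sub_eq_zero.1 (congrFun hg d)
  have hE : Module.finrank K (G.antisymmetric K) ≤ Nat.card G.Edge := finrank_antisymmetric_le
  have heuler : Nat.card G.Vertex + Nat.card G.Face = Nat.card G.Edge + 2 := G.euler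
  rw [← Submodule.eq_of_le_of_finrank_le hsup (by omega)] at hc
  obtain ⟨_, ⟨p, rfl⟩, _, ⟨g, rfl⟩, h⟩ := Submodule.mem_sup.1 hc
  exact ⟨p, g, h.symm⟩

theorem exists_eq_vertexCoboundary {c : D → K} (hc : c ∈ G.antisymmetric K)
    (h : ∀ g : G.Face → K, (g ∘ G.left) ⬝ᵥ c = 0) : ∃ p, c = G.vertexCoboundary K p := by
  obtain ⟨p, g, rfl⟩ := exists_eq_vertexCoboundary_add_faceCoboundary hc
  have horth := faceCoboundary_dotProduct hc g
  rw [h, mul_zero, dotProduct_add, dotProduct_comm,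
    vertexCoboundary_dotProduct_faceCoboundary, zero_add, dotProduct_self_eq_zero] at horth
  exact ⟨p, by rw [horth, add_zero]⟩

theorem exists_eq_faceCoboundary {c : D → K} (hc : c ∈ G.antisymmetric K)
    (h : ∀ p : G.Vertex → K, (p ∘ G.tail) ⬝ᵥ c = 0) : ∃ g, c = G.faceCoboundary K g := by
  obtain ⟨p, g, rfl⟩ := exists_eq_vertexCoboundary_add_faceCoboundary hc
  have horth := vertexCoboundary_dotProduct hc p
  rw [h, mul_zero, dotProduct_add, vertexCoboundary_dotProduct_faceCoboundary, add_zero,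
    dotProduct_self_eq_zero] at horth
  exact ⟨g, by rw [horth, zero_add]⟩

end Hodge

section Integer

theorem floor_sub_floor_eq {a b : ℚ} {n : ℤ} (h : (n : ℚ) = a - b) : n = ⌊a⌋ - ⌊b⌋ := by
  rw [← sub_add_cancel a b, ← h, add_comm, Int.floor_add_intCast, add_sub_cancel_left]

theorem sum_natAbs_sub_single_lt {ι : Type*} [Fintype ι] [DecidableEq ι] {p : ι → ℤ}
    {i : ι} (hi : 0 < p i) : ∑ j, ((p - Pi.single i 1 : ι → ℤ) j).natAbs < ∑ j, (p j).natAbs := by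
  refine Finset.sum_lt_sum (fun j _ => ?_) ⟨i, Finset.mem_univ i, ?_⟩
  · obtain rfl | hj := eq_or_ne j i
    · rw [Pi.sub_apply, Pi.single_eq_same]
      omega
    · rw [Pi.sub_apply, Pi.single_eq_of_ne hj, sub_zero]
  · rw [Pi.sub_apply, Pi.single_eq_same]
    omega

variable [Fintype D] {c : D → ℤ}

theorem exists_eq_head_sub_tail (hc : ∀ d, c (G.rev d) = -c d)
    (h : ∀ g : G.Face → ℚ, ∑ d, g (G.left d) * c d = 0) :
    ∃ p : G.Vertex → ℤ, ∀ d, c d = p (G.head d) - p (G.tail d) := by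
  obtain ⟨p, hp⟩ := exists_eq_vertexCoboundary (c := fun d => (c d : ℚ))
    (fun d => by simp only [hc, Int.cast_neg]) h
  exact ⟨fun v => ⌊p v⌋, fun d => floor_sub_floor_eq (congrFun hp d)⟩

theorem exists_eq_left_sub_right (hc : ∀ d, c (G.rev d) = -c d)
    (h : ∀ p : G.Vertex → ℚ, ∑ d, p (G.tail d) * c d = 0) :
    ∃ g : G.Face → ℤ, ∀ d, c d = g (G.left d) - g (G.right d) := by
  obtain ⟨g, hg⟩ := exists_eq_faceCoboundary (c := fun d => (c d : ℚ))
    (fun d => by simp only [hc, Int.cast_neg]) h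
  exact ⟨fun F => ⌊g F⌋, fun d => floor_sub_floor_eq (congrFun hg d)⟩

end Integer

variable (G) in
/-- The primal graph with both directions of every edge. -/
def dartGraph : DirectedMultigraph G.Vertex D := ⟨G.tail, G.head⟩

theorem exists_windingNumber [Finite D] {X : Set D} (hX : G.dartGraph.IsCycle X)
    (hrev : ∀ d ∈ X, G.rev d ∉ X) : ∃ g : G.Face → ℤ,
      (∀ d ∈ X, g (G.left d) = g (G.right d) + 1) ∧ ∀ d ∉ X, g (G.left d) ≤ g (G.right d) := by
  classical
  have := Fintype.ofFinite D
  let c : D → ℤ := fun d => X.indicator 1 d - X.indicator 1 (G.rev d)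
  have hanti (d : D) : c (G.rev d) = -c d := by simp only [c, G.rev_rev, neg_sub]
  have hdiv (p : G.Vertex → ℚ) : ∑ d, p (G.tail d) * c d = 0 := by
    have hcycle : ∑ d, X.indicator (p ∘ G.tail) d = ∑ d, X.indicator (p ∘ G.head) d := by
      have h := hX.finsum_mem_src_eq p
      rwa [finsum_mem_def, finsum_mem_def, finsum_eq_sum_of_fintype,
        finsum_eq_sum_of_fintype] at h
    have hrev : ∑ d, X.indicator (p ∘ G.head) d = ∑ d, X.indicator (p ∘ G.head) (G.rev d) :=
      (Equiv.sum_comp G.rev _).symm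
    rw [← sub_eq_zero, hrev, ← Finset.sum_sub_distrib] at hcycle
    rw [← hcycle]
    refine Finset.sum_congr rfl fun d _ => ?_
    simp only [c, Set.indicator_apply, Function.comp_apply, head_rev, Pi.one_apply]
    push_cast
    simp only [mul_sub, mul_ite, mul_one, mul_zero]
  obtain ⟨g, hg⟩ := exists_eq_left_sub_right hanti hdiv
  refine ⟨g, fun d hd => ?_, fun d hd => ?_⟩
  · have hcd : c d = 1 := by
      simp only [c, Set.indicator_of_mem hd, Set.indicator_of_notMem (hrev d hd), Pi.one_apply,
        sub_zero]
    linarith [hg d]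
  · have hcd : c d ≤ 0 := by
      rw [sub_nonpos, Set.indicator_of_notMem hd]
      exact Set.indicator_nonneg (fun _ _ => zero_le_one) _
    linarith [hg d]

/-! ### Every edge lies on a bounded face -/

/-- The dart `b` is a bridge, and `A` consists of the vertices on the side of its head: apart from
the edge of `b`, no edge joins `A` to its complement. -/
structure IsBridgeSide (b : D) (A : Set G.Vertex) : Prop where
  head_mem : G.head b ∈ A
  tail_notMem : G.tail b ∉ A
  head_mem_iff_tail_mem : ∀ d, d ≠ b → d ≠ G.rev b → (G.head d ∈ A ↔ G.tail d ∈ A)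

theorem rev_eq_iff {d b : D} : G.rev d = b ↔ d = G.rev b :=
  ⟨fun h => by rw [← h, G.rev_rev], fun h => by rw [h, G.rev_rev]⟩

theorem IsBridgeSide.compl {b : D} {A : Set G.Vertex} (hA : IsBridgeSide b A) :
    IsBridgeSide (G.rev b) Aᶜ where
  head_mem := by
    rw [head_rev]
    exact hA.tail_notMem
  tail_notMem := not_not_intro hA.head_mem
  head_mem_iff_tail_mem d hd hd' := by
    rw [G.rev_rev] at hd'
    exact not_congr (hA.head_mem_iff_tail_mem d hd' hd)

/-- The unit flow along `b` has no divergence at any face, so it is the coboundary of a function on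
the vertices, of which `A` is a level set. -/
theorem exists_isBridgeSide [Finite D] {b : D} (hb : G.left b = G.right b) :
    ∃ A : Set G.Vertex, IsBridgeSide b A := by
  classical
  have := Fintype.ofFinite D
  let c : D → ℤ := fun d => (if d = b then 1 else 0) - (if d = G.rev b then 1 else 0)
  have hanti (d : D) : c (G.rev d) = -c d := by
    simp only [c, rev_eq_iff, G.rev_rev, neg_sub]
  have horth (g : G.Face → ℚ) : ∑ d, g (G.left d) * c d = 0 := by
    simp only [c, Int.cast_sub, Int.cast_ite, Int.cast_one, Int.cast_zero, mul_sub,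
      Finset.sum_sub_distrib, mul_ite, mul_one, mul_zero, Finset.sum_ite_eq', Finset.mem_univ,
      if_true, left_rev, hb, sub_self]
  obtain ⟨p, hp⟩ := exists_eq_head_sub_tail hanti horth
  refine ⟨{v | p v = p (G.head b)}, rfl, fun htail => ?_, fun d hd hd' => ?_⟩
  · have hcb : c b = 1 := by
      simp only [c, if_true, (G.rev_ne b).symm, if_false, sub_zero]
    have htail : p (G.tail b) = p (G.head b) := htail
    linarith [hp b]
  · have hcd : c d = 0 := by
      simp only [c, hd, hd', if_false, sub_zero]
    have hp_eq : p (G.head d) = p (G.tail d) := by linarith [hp d]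
    simp only [Set.mem_ofPred_eq, hp_eq]

theorem head_ne_tail_of_left_eq_right [Finite D] {b : D} (hb : G.left b = G.right b) :
    G.head b ≠ G.tail b := fun h => by
  obtain ⟨A, hA⟩ := exists_isBridgeSide hb
  exact hA.tail_notMem (h ▸ hA.head_mem)

theorem IsBridgeSide.ssubset {b d : D} {A B : Set G.Vertex} (hA : IsBridgeSide b A)
    (hB : IsBridgeSide d B) (hbd : G.tail d = G.head b) (hne : d ≠ G.rev b) : B ⊂ A := by
  have hne' : d ≠ b := fun h => hA.tail_notMem (h ▸ hbd ▸ hA.head_mem)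
  have htail : G.tail d ∈ A := hbd ▸ hA.head_mem
  have hhead : G.head d ∈ A := (hA.head_mem_iff_tail_mem d hne' hne).2 htail
  have hb_head : G.head b ∉ B := hbd ▸ hB.tail_notMem
  have hb_tail : G.tail b ∉ B := fun h => hb_head <|
    (hB.head_mem_iff_tail_mem b hne'.symm fun h => hne (rev_eq_iff.1 h.symm)).2 h
  -- No edge joins `B \ A` to its complement, because neither `b` nor `d` does.
  have hinv (e : D) : (G.head e ∈ B \ A) = (G.tail e ∈ B \ A) := by
    simp only [Set.mem_sdiff]
    by_cases hb : G.edge e = G.edge b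
    · obtain rfl | rfl := edge_eq_iff.1 hb
      · simp only [hb_head, hb_tail, false_and]
      · simp only [head_rev, tail_rev, hb_head, hb_tail, false_and]
    by_cases hd : G.edge e = G.edge d
    · obtain rfl | rfl := edge_eq_iff.1 hd
      · simp only [htail, hhead, not_true, and_false]
      · simp only [head_rev, tail_rev, htail, hhead, not_true, and_false]
    rw [edge_eq_iff, not_or] at hb hd
    rw [hA.head_mem_iff_tail_mem e hb.1 hb.2, hB.head_mem_iff_tail_mem e hd.1 hd.2]
  refine ⟨fun v hv => ?_, fun h => hb_head (h hA.head_mem)⟩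
  by_contra hvA
  have h := eq_of_head_eq_tail (p := (· ∈ B \ A)) hinv v (G.head b)
  exact hb_head (h.mp ⟨hv, hvA⟩).1

theorem IsBridgeSide.exists_left_ne_outer [Finite D] (hleaf : G.NoLeaves) {b : D}
    {A : Set G.Vertex} (hA : IsBridgeSide b A) (hb : G.right b = G.outer) :
    ∃ a, G.tail a ∈ A ∧ G.left a ≠ G.outer := by
  induction hn : A.ncard using Nat.strong_induction_on generalizing b A with
  | h n ih =>
    -- Walk on along the boundary of the unbounded face.
    let d := G.next (G.rev b)
    have htail : G.tail d = G.head b := tail_next _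
    have hright : G.right d = G.outer := (right_next _).trans hb
    by_cases hleft : G.left d = G.outer
    · obtain ⟨B, hB⟩ := exists_isBridgeSide (hleft.trans hright.symm)
      have hBA := hA.ssubset hB htail (hleaf _)
      obtain ⟨a, haB, ha⟩ := ih _ (hn ▸ Set.ncard_lt_ncard hBA) hB hright rfl
      exact ⟨a, hBA.1 haB, ha⟩
    · exact ⟨d, htail ▸ hA.head_mem, hleft⟩

theorem NoProperContractible.three_mul_ncard_lt (hcon : G.NoProperContractible)
    {S : Set G.BoundedFace} (hne : S.Nonempty) (huniv : S ≠ Set.univ) :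
    3 * S.ncard < (G.edgesOf S).ncard := by
  have h := hcon S hne huniv
  rw [Contractible] at h
  omega

theorem edgesOf_inter_edgesOf_compl_nonempty [Finite D]
    (hcard : Nat.card G.Edge = 3 * Nat.card G.BoundedFace) (hcon : G.NoProperContractible)
    {S : Set G.BoundedFace} (hne : S.Nonempty) (huniv : S ≠ Set.univ) :
    (G.edgesOf S ∩ G.edgesOf Sᶜ).Nonempty := by
  by_contra! hempty
  have hS := hcon.three_mul_ncard_lt hne huniv
  have hS' := hcon.three_mul_ncard_lt (Set.nonempty_compl.2 huniv)
    (mt Set.compl_univ_iff.1 hne.ne_empty)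
  have hunion := Set.ncard_union_eq (Set.disjoint_iff_inter_eq_empty.2 hempty)
  have hle := Set.ncard_le_card (G.edgesOf S ∪ G.edgesOf Sᶜ)
  have hcompl := Set.ncard_add_ncard_compl S
  omega

theorem IsBridgeSide.tail_mem_iff_of_left_eq [Finite D] {b : D} {A : Set G.Vertex}
    (hA : IsBridgeSide b A) {F : G.Face} (hl : G.left b ≠ F) (hr : G.right b ≠ F) {a a' : D}
    (ha : G.left a = F) (ha' : G.left a' = F) : G.tail a ∈ A ↔ G.tail a' ∈ A := by
  refine iff_of_eq (tail_eq_of_forall_left_eq (p := (· ∈ A)) (fun d hd => ?_) ha ha')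
  refine propext (hA.head_mem_iff_tail_mem d (fun h => hl (h ▸ hd)) fun h => hr ?_)
  rw [right, ← h, hd]

theorem left_ne_outer_or_right_ne_outer [Finite D] (hleaf : G.NoLeaves)
    (hcard : Nat.card G.Edge = 3 * Nat.card G.BoundedFace) (hcon : G.NoProperContractible)
    (b : D) : G.left b ≠ G.outer ∨ G.right b ≠ G.outer := by
  by_contra! hb
  obtain ⟨hl, hr⟩ := hb
  obtain ⟨A, hA⟩ := exists_isBridgeSide (hl.trans hr.symm)
  obtain ⟨a, haA, ha⟩ := hA.exists_left_ne_outer hleaf hr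
  obtain ⟨a', haA', ha'⟩ := hA.compl.exists_left_ne_outer hleaf ((right_rev b).trans hl)
  let S : Set G.BoundedFace := {F | ∃ d, G.left d = F.1 ∧ G.tail d ∈ A}
  have mem_iff (F : G.BoundedFace) (d : D) (hd : G.left d = F.1) : F ∈ S ↔ G.tail d ∈ A := by
    refine ⟨fun ⟨d', hd', hA'⟩ => ?_, fun h => ⟨d, hd, h⟩⟩
    exact (hA.tail_mem_iff_of_left_eq (hl.trans_ne F.2.symm) (hr.trans_ne F.2.symm) hd' hd).1 hA'
  have haS : ⟨_, ha⟩ ∈ S := (mem_iff _ a rfl).2 haA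
  have haS' : ⟨_, ha'⟩ ∉ S := fun h => haA' ((mem_iff _ a' rfl).1 h)
  obtain ⟨e, ⟨F, hF, d, hd, hdF⟩, F', hF', d', hd', hdF'⟩ :=
    edgesOf_inter_edgesOf_compl_nonempty hcard hcon ⟨_, haS⟩
      fun h => haS' (h ▸ Set.mem_univ _)
  rw [mem_iff F d hdF] at hF
  rw [Set.mem_compl_iff, mem_iff F' d' hdF'] at hF'
  have hdb : d ≠ b := by
    rintro rfl
    exact F.2 (hdF.symm.trans hl)
  have hdb' : d ≠ G.rev b := by
    rintro rfl
    exact F.2 (hdF.symm.trans hr)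
  obtain rfl | rfl := edge_eq_iff.1 (hd'.trans hd.symm)
  · exact hF' hF
  · exact hF' ((hA.head_mem_iff_tail_mem d hdb hdb').2 hF)

theorem edgesOf_univ [Finite D] (hleaf : G.NoLeaves)
    (hcard : Nat.card G.Edge = 3 * Nat.card G.BoundedFace) (hcon : G.NoProperContractible) :
    G.edgesOf Set.univ = Set.univ := by
  refine Set.eq_univ_of_forall fun e => ?_
  obtain ⟨d, rfl⟩ := edge_surjective e
  obtain h | h := left_ne_outer_or_right_ne_outer hleaf hcard hcon d
  · exact ⟨⟨_, h⟩, Set.mem_univ _, onFace_edge_iff.2 (Or.inl rfl)⟩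
  · exact ⟨⟨_, h⟩, Set.mem_univ _, onFace_edge_iff.2 (Or.inr rfl)⟩

/-! ### Existence of edge-injective functions -/

/-- Hall's theorem for systems of disjoint representing sets: apply it to `k` copies of each
index. -/
theorem exists_pairwise_disjoint_card_eq {ι α : Type*} [DecidableEq α] {k : ℕ}
    {t : ι → Finset α} (h : ∀ s : Finset ι, k * s.card ≤ (s.biUnion t).card) :
    ∃ f : ι → Finset α, (∀ i, (f i).card = k) ∧ (∀ i, f i ⊆ t i) ∧
      Pairwise fun i j => Disjoint (f i) (f j) := by
  classical
  have hall (s : Finset (ι × Fin k)) : s.card ≤ (s.biUnion fun x => t x.1).card := by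
    calc s.card ≤ (s.image Prod.fst ×ˢ (Finset.univ : Finset (Fin k))).card :=
          Finset.card_le_card fun x hx =>
            Finset.mem_product.2 ⟨Finset.mem_image_of_mem _ hx, Finset.mem_univ _⟩
      _ = k * (s.image Prod.fst).card := by
          rw [Finset.card_product, Finset.card_univ, Fintype.card_fin, mul_comm]
      _ ≤ ((s.image Prod.fst).biUnion t).card := h _
      _ = (s.biUnion fun x => t x.1).card := by rw [Finset.image_biUnion]
  obtain ⟨f, hf, hft⟩ := (Finset.all_card_le_biUnion_card_iff_exists_injective _).1 hall
  refine ⟨fun i => Finset.univ.image fun j => f (i, j), fun i => ?_, fun i => ?_,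
    fun i i' hne => ?_⟩
  · rw [Finset.card_image_of_injective _ fun j j' h => congrArg Prod.snd (hf h),
      Finset.card_univ, Fintype.card_fin]
  · exact Finset.image_subset_iff.2 fun j _ => hft (i, j)
  · refine Finset.disjoint_left.2 fun a ha ha' => ?_
    obtain ⟨j, -, rfl⟩ := Finset.mem_image.1 ha
    obtain ⟨j', -, h⟩ := Finset.mem_image.1 ha'
    exact hne (congrArg Prod.fst (hf h)).symm

theorem nonempty_edgeInjective [Finite D] (hleaf : G.NoLeaves)
    (hcard : Nat.card G.Edge = 3 * Nat.card G.BoundedFace) (hcon : G.NoProperContractible) :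
    Nonempty G.EdgeInjective := by
  classical
  have := Fintype.ofFinite G.Edge
  let t (F : G.BoundedFace) : Finset G.Edge := {e | G.OnFace e F.1}
  have coe_biUnion (S : Finset G.BoundedFace) :
      (S.biUnion t : Set G.Edge) = G.edgesOf (S : Set G.BoundedFace) := by
    ext e
    simp only [t, edgesOf, Finset.mem_coe, Finset.mem_biUnion, Finset.mem_filter,
      Finset.mem_univ, true_and, Set.mem_ofPred_eq]
  have hall (S : Finset G.BoundedFace) : 3 * S.card ≤ (S.biUnion t).card := by
    rw [← Set.ncard_coe_finset, ← Set.ncard_coe_finset, coe_biUnion]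
    obtain hempty | hne := (S : Set G.BoundedFace).eq_empty_or_nonempty
    · rw [hempty, Set.ncard_empty]
      exact Nat.zero_le _
    by_cases huniv : (S : Set G.BoundedFace) = Set.univ
    · rw [huniv, edgesOf_univ hleaf hcard hcon, Set.ncard_univ, Set.ncard_univ, hcard]
    · exact (hcon.three_mul_ncard_lt hne huniv).le
  obtain ⟨φ, hφ, hsub, hdisj⟩ := exists_pairwise_disjoint_card_eq hall
  exact ⟨φ, hφ, fun F e he => (Finset.mem_filter.1 (hsub F he)).2, fun F F' => @hdisj F F'⟩

/-! ### The orientation of the dual graph -/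

open Classical in
/-- The face on the side of the edge `e` that is not `F`, if `e` lies on `F`. It is `F` itself if
`e` has `F` on both sides. -/
noncomputable def across (e : G.Edge) (F : G.Face) : G.Face :=
  if G.left e.out = F then G.right e.out else G.left e.out

theorem across_edge_left (d : D) : G.across (G.edge d) (G.left d) = G.right d := by
  rw [across]
  obtain h | h := edge_eq_iff.1 (Quotient.out_eq (G.edge d) : G.edge (G.edge d).out = G.edge d)
  · rw [h, if_pos rfl]
  · rw [h, right_rev, left_rev]
    split_ifs with hlr
    · exact hlr.symm
    · rfl

namespace EdgeInjective

open DirectedMultigraph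

variable (φ ψ : G.EdgeInjective) {C : Set G.Edge} {e : G.Edge} {d : D}

open Classical in
/-- The face to which `φ` assigns the edge `e`. If there is none, this is the unbounded face. -/
noncomputable def target (e : G.Edge) : G.Face :=
  if h : ∃ F, e ∈ φ.1 F then h.choose.1 else G.outer

/-- The dual graph of `G`, with a vertex for the unbounded face, in the orientation given by `φ`:
each edge ends at the face to which `φ` assigns it and starts at the face across. The loops of the
modified dual at outer edges become arcs that leave the unbounded face. -/
noncomputable def dual : DirectedMultigraph G.Face G.Edge where
  tgt := φ.target
  src e := G.across e (φ.target e)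

variable {φ ψ}

theorem dual_src : φ.dual.src e = G.across e (φ.dual.tgt e) := rfl

theorem dual_tgt_eq_iff {F : G.BoundedFace} : φ.dual.tgt e = F.1 ↔ e ∈ φ.1 F := by
  change φ.target e = F.1 ↔ _
  rw [target]
  constructor
  · intro h
    split_ifs at h with hex
    · exact Subtype.ext h ▸ hex.choose_spec
    · exact absurd h.symm F.2
  · intro h
    have hex : ∃ F, e ∈ φ.1 F := ⟨F, h⟩
    rw [dif_pos hex]
    by_contra hne
    exact Finset.disjoint_left.1 (φ.2.2.2 _ F fun h' => hne (congrArg _ h')) hex.choose_spec h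

theorem eq_of_dual_tgt_eq (h : ∀ e, φ.dual.tgt e = ψ.dual.tgt e) : φ = ψ :=
  Subtype.ext <| funext fun F => Finset.ext fun e => by
    rw [← dual_tgt_eq_iff, h, dual_tgt_eq_iff]

theorem dual_src_edge (h : φ.dual.tgt (G.edge d) = G.left d) :
    φ.dual.src (G.edge d) = G.right d := by
  rw [dual_src, h, across_edge_left]

theorem dual_src_edge_of_eq_right (h : φ.dual.tgt (G.edge d) = G.right d) :
    φ.dual.src (G.edge d) = G.left d := by
  rw [← edge_rev, dual_src_edge (by rwa [edge_rev]), right_rev]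

theorem exists_edge_eq_left_eq_right_eq (h : φ.dual.tgt e ≠ G.outer) :
    ∃ d, G.edge d = e ∧ G.left d = φ.dual.tgt e ∧ G.right d = φ.dual.src e := by
  have hmem : e ∈ φ.1 ⟨_, h⟩ := dual_tgt_eq_iff.1 rfl
  obtain ⟨d, rfl, hd⟩ := φ.2.2.1 _ e hmem
  exact ⟨d, rfl, hd, (dual_src_edge hd.symm).symm⟩

theorem arrow_iff {F F' : G.BoundedFace} : Arrow φ e F F' ↔
    φ.dual.tgt e = F'.1 ∧ (φ.dual.src e = F.1 ∨ φ.dual.src e = G.outer ∧ F = F') := by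
  rw [Arrow, ← dual_tgt_eq_iff, and_comm]
  refine and_congr_right fun h => ?_
  obtain ⟨d, rfl, hl, hr⟩ := exists_edge_eq_left_eq_right_eq (h.trans_ne F'.2)
  rw [← hr, DualJoins]
  simp only [onFace_edge_iff, hl, h]
  constructor
  · rintro (⟨hne, hF, -⟩ | ⟨rfl, -, honly⟩)
    · exact Or.inl (hF.resolve_left fun h => hne (Subtype.ext h)).symm
    · by_cases hout : G.right d = G.outer
      · exact Or.inr ⟨hout, rfl⟩
      · exact Or.inl (congrArg Subtype.val (honly ⟨_, hout⟩ (Or.inr rfl)))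
  · rintro (hF | ⟨hout, rfl⟩)
    · by_cases heq : F = F'
      · subst heq
        exact Or.inr ⟨rfl, Or.inl rfl, fun F'' h'' =>
          Subtype.ext (h''.elim id fun h'' => h''.trans hF)⟩
      · exact Or.inl ⟨heq, Or.inr hF.symm, Or.inl trivial⟩
    · exact Or.inr ⟨rfl, Or.inl rfl, fun F'' h'' =>
        Subtype.ext (h''.resolve_right fun h'' => F''.2 (h''.trans hout))⟩

section Card

variable [Finite D] (hcard : Nat.card G.Edge = 3 * Nat.card G.BoundedFace)

include hcard

theorem exists_mem (φ : G.EdgeInjective) (e : G.Edge) : ∃ F, e ∈ φ.1 F := by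
  classical
  have := Fintype.ofFinite G.Edge
  have := Fintype.ofFinite G.BoundedFace
  have hunion : (Finset.univ.biUnion φ.1).card = (Finset.univ : Finset G.Edge).card := by
    rw [Finset.card_biUnion fun F _ F' _ h => φ.2.2.2 F F' h,
      Finset.sum_congr rfl fun F _ => φ.2.1 F, Finset.sum_const, smul_eq_mul, mul_comm,
      Finset.card_univ, Finset.card_univ, ← Nat.card_eq_fintype_card,
      ← Nat.card_eq_fintype_card, hcard]
  have he : e ∈ Finset.univ.biUnion φ.1 :=
    (Finset.card_eq_iff_eq_univ _).1 hunion ▸ Finset.mem_univ e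
  obtain ⟨F, -, hF⟩ := Finset.mem_biUnion.1 he
  exact ⟨F, hF⟩

theorem dual_tgt_ne_outer (φ : G.EdgeInjective) (e : G.Edge) : φ.dual.tgt e ≠ G.outer := by
  obtain ⟨F, hF⟩ := exists_mem hcard φ e
  exact (dual_tgt_eq_iff.2 hF).trans_ne F.2

theorem dual_tgt_edge (φ : G.EdgeInjective) (d : D) :
    φ.dual.tgt (G.edge d) = G.left d ∨ φ.dual.tgt (G.edge d) = G.right d := by
  obtain ⟨d', hd', hl, -⟩ := exists_edge_eq_left_eq_right_eq (dual_tgt_ne_outer hcard φ (G.edge d))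
  rw [← hl]
  obtain rfl | rfl := edge_eq_iff.1 hd'
  · exact Or.inl rfl
  · exact Or.inr rfl

theorem across_dual_src (φ : G.EdgeInjective) (e : G.Edge) :
    G.across e (φ.dual.src e) = φ.dual.tgt e := by
  obtain ⟨d, rfl, hl, hr⟩ := exists_edge_eq_left_eq_right_eq (dual_tgt_ne_outer hcard φ e)
  rw [← hr, ← hl, ← left_rev, ← edge_rev, across_edge_left, right_rev]

theorem ncard_dual_tgt_eq (φ ψ : G.EdgeInjective) (F : G.Face) :
    {e | φ.dual.tgt e = F}.ncard = {e | ψ.dual.tgt e = F}.ncard := by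
  by_cases hF : F = G.outer
  · simp only [hF, dual_tgt_ne_outer hcard]
  · have ncard_eq (φ : G.EdgeInjective) : {e | φ.dual.tgt e = F}.ncard = 3 := by
      rw [← φ.2.1 ⟨F, hF⟩, ← Set.ncard_coe_finset]
      congr 1
      ext e
      exact dual_tgt_eq_iff (F := ⟨F, hF⟩)
    rw [ncard_eq, ncard_eq]

theorem dual_eq_reverse_of_tgt_eq (h : ∀ e, ψ.dual.tgt e = (φ.dual.reverse C).tgt e) :
    ψ.dual = φ.dual.reverse C := by
  refine DirectedMultigraph.ext (funext fun e => ?_) (funext h)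
  rw [dual_src, h]
  by_cases he : e ∈ C
  · rw [reverse_tgt_of_mem he, reverse_src_of_mem he, across_dual_src hcard]
  · rw [reverse_tgt_of_notMem he, reverse_src_of_notMem he, dual_src]

theorem isBalanced_of_dual_eq_reverse (h : ψ.dual = φ.dual.reverse C) : φ.dual.IsBalanced C := by
  rw [isBalanced_iff_ncard_reverse_tgt, ← h]
  exact ncard_dual_tgt_eq hcard ψ φ

theorem exists_dual_eq_reverse (hC : φ.dual.IsBalanced C) :
    ∃ ψ : G.EdgeInjective, ψ.dual = φ.dual.reverse C := by
  classical
  have := Fintype.ofFinite G.Edge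
  let Γ := φ.dual.reverse C
  have hΓ (F : G.Face) : {e | Γ.tgt e = F}.ncard = {e | φ.dual.tgt e = F}.ncard :=
    isBalanced_iff_ncard_reverse_tgt.1 hC F
  have onFace (e : G.Edge) : G.OnFace e (Γ.tgt e) := by
    obtain ⟨d, rfl, hl, hr⟩ := exists_edge_eq_left_eq_right_eq (dual_tgt_ne_outer hcard φ e)
    rw [onFace_edge_iff, hl, hr]
    exact (em (G.edge d ∈ C)).symm.imp reverse_tgt_of_notMem reverse_tgt_of_mem
  have tgt_ne_outer (e : G.Edge) : Γ.tgt e ≠ G.outer := by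
    have hempty := hΓ G.outer
    simp only [dual_tgt_ne_outer hcard φ, Set.ofPred_false, Set.ncard_empty,
      Set.ncard_eq_zero (Set.toFinite _)] at hempty
    exact Set.eq_empty_iff_forall_notMem.1 hempty e
  let ψ : G.EdgeInjective := ⟨fun F => {e | Γ.tgt e = F.1}, fun F => by
    rw [← φ.2.1 F, ← Set.ncard_coe_finset, ← Set.ncard_coe_finset, Finset.coe_filter_univ, hΓ]
    simp only [dual_tgt_eq_iff, SetLike.setOfPred_mem_eq], fun F e he => by
      rw [← (Finset.mem_filter.1 he).2]
      exact onFace e, fun F F' hne => Finset.disjoint_left.2 fun e he he' =>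
        hne (Subtype.ext ((Finset.mem_filter.1 he).2.symm.trans (Finset.mem_filter.1 he').2))⟩
  refine ⟨ψ, dual_eq_reverse_of_tgt_eq hcard fun e => ?_⟩
  exact dual_tgt_eq_iff (F := ⟨_, tgt_ne_outer e⟩).2
    (Finset.mem_filter.2 ⟨Finset.mem_univ e, rfl⟩)

theorem reverses_of_dual_eq_reverse (h : ψ.dual = φ.dual.reverse C) : Reverses C φ ψ := by
  constructor
  · intro e he F F'
    rw [arrow_iff, arrow_iff, h, reverse_src_of_notMem he, reverse_tgt_of_notMem he]
  · intro e he F F'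
    have hsrc : φ.dual.src e ≠ G.outer := by
      rw [← reverse_tgt_of_mem he, ← h]
      exact dual_tgt_ne_outer hcard ψ e
    rw [arrow_iff, arrow_iff, h, reverse_src_of_mem he, reverse_tgt_of_mem he]
    simp only [hsrc, dual_tgt_ne_outer hcard φ e, false_and, or_false, and_comm]

theorem isDirectedCycle_iff : IsDirectedCycle φ C ↔
    φ.dual.IsCycle C ∧ ∀ e ∈ C, φ.dual.src e ≠ φ.dual.tgt e := by
  constructor
  · rintro ⟨n, F, e, hF, he, rfl⟩
    have hne (i : Fin (n + 2)) : F i ≠ F (i + 1) := fun h =>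
      one_ne_zero (left_eq_add.1 (hF h))
    have htgt (i : Fin (n + 2)) : φ.dual.tgt (e i) = (F (i + 1)).1 := (arrow_iff.1 (he i)).1
    have hsrc (i : Fin (n + 2)) : φ.dual.src (e i) = (F i).1 :=
      (arrow_iff.1 (he i)).2.resolve_right fun h => hne i h.2
    refine ⟨⟨n + 1, fun i => (F i).1, e, Subtype.val_injective.comp hF,
      fun i => ⟨hsrc i, htgt i⟩, rfl⟩, ?_⟩
    rintro _ ⟨i, rfl⟩
    rw [hsrc, htgt]
    exact fun h => hne i (Subtype.ext h)
  · rintro ⟨⟨n, x, e, hx, he, rfl⟩, hloop⟩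
    obtain _ | n := n
    · exact absurd ((he 0).1.trans (he 0).2.symm) (hloop _ ⟨0, rfl⟩)
    have hne (i : Fin (n + 2)) : x i ≠ G.outer := by
      rw [← sub_add_cancel i 1, ← (he (i - 1)).2]
      exact dual_tgt_ne_outer hcard φ _
    exact ⟨n, fun i => ⟨x i, hne i⟩, e, fun i j h => hx (congrArg Subtype.val h),
      fun i => arrow_iff.2 ⟨(he i).2, Or.inl (he i).1⟩, rfl⟩

theorem isGenDirectedCycle_iff : IsGenDirectedCycle φ C ↔
    C.Nonempty ∧ φ.dual.IsBalanced C ∧ ∀ e ∈ C, φ.dual.src e ≠ φ.dual.tgt e := by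
  simp only [IsGenDirectedCycle, isDirectedCycle_iff hcard]
  constructor
  · rintro ⟨𝒞, ⟨c, hc⟩, h𝒞, hdisj, rfl⟩
    refine ⟨(h𝒞 c hc).1.nonempty.mono (Set.subset_sUnion_of_mem hc),
      IsBalanced.sUnion (fun c hc => (h𝒞 c hc).1.isBalanced) hdisj, ?_⟩
    rintro e ⟨c, hc, he⟩
    exact (h𝒞 c hc).2 e he
  · rintro ⟨⟨e, he⟩, hbal, hloop⟩
    obtain ⟨𝒞, h𝒞, hdisj, rfl⟩ := hbal.exists_eq_sUnion_isCycle
    obtain ⟨c, hc, -⟩ := he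
    exact ⟨𝒞, ⟨c, hc⟩, fun c hc => ⟨h𝒞 c hc, fun e he => hloop e ⟨c, hc, he⟩⟩, hdisj, rfl⟩

end Card

/-! ### Reversing directed cycles -/

/-- The edges that are oriented differently by `φ` and `ψ`. -/
def diff (φ ψ : G.EdgeInjective) : Set G.Edge := {e | φ.dual.tgt e ≠ ψ.dual.tgt e}

theorem diff_eq_empty_iff : diff φ ψ = ∅ ↔ φ = ψ := by
  constructor
  · intro h
    exact eq_of_dual_tgt_eq fun e => not_not.1 (Set.eq_empty_iff_forall_notMem.1 h e)
  · rintro rfl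
    exact Set.eq_empty_of_forall_notMem fun e he => he rfl

theorem diff_eq_of_dual_eq_reverse (h : ψ.dual = φ.dual.reverse C)
    (hC : ∀ e ∈ C, φ.dual.src e ≠ φ.dual.tgt e) : diff φ ψ = C := by
  ext e
  rw [diff, Set.mem_ofPred_eq, h]
  by_cases he : e ∈ C
  · rw [reverse_tgt_of_mem he]
    exact iff_of_true (hC e he).symm he
  · rw [reverse_tgt_of_notMem he]
    exact iff_of_false (not_not_intro rfl) he

section Card

variable [Finite D] (hcard : Nat.card G.Edge = 3 * Nat.card G.BoundedFace)

include hcard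

theorem dual_tgt_eq_src_of_mem_diff (he : e ∈ diff φ ψ) : ψ.dual.tgt e = φ.dual.src e := by
  obtain ⟨d, rfl, hl, hr⟩ := exists_edge_eq_left_eq_right_eq (dual_tgt_ne_outer hcard φ e)
  rw [← hr]
  exact (dual_tgt_edge hcard ψ d).resolve_left fun h => he (hl.symm.trans h.symm)

theorem src_ne_tgt_of_mem_diff (he : e ∈ diff φ ψ) : φ.dual.src e ≠ φ.dual.tgt e :=
  dual_tgt_eq_src_of_mem_diff hcard he ▸ Ne.symm he

theorem dual_eq_reverse_diff (φ ψ : G.EdgeInjective) :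
    ψ.dual = φ.dual.reverse (diff φ ψ) := by
  refine dual_eq_reverse_of_tgt_eq hcard fun e => ?_
  by_cases he : e ∈ diff φ ψ
  · rw [reverse_tgt_of_mem he, dual_tgt_eq_src_of_mem_diff hcard he]
  · rw [reverse_tgt_of_notMem he]
    exact (not_not.1 he).symm

theorem reflTransGen_reverses_isDirectedCycle (φ ψ : G.EdgeInjective) :
    Relation.ReflTransGen (fun χ χ' : G.EdgeInjective =>
      ∃ C, IsDirectedCycle χ C ∧ Reverses C χ χ') φ ψ := by
  induction hn : (diff φ ψ).ncard using Nat.strong_induction_on generalizing φ with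
  | h n ih =>
    obtain hempty | hne := (diff φ ψ).eq_empty_or_nonempty
    · rw [diff_eq_empty_iff.1 hempty]
    have hbal := isBalanced_of_dual_eq_reverse hcard (dual_eq_reverse_diff hcard φ ψ)
    obtain ⟨c, hsub, hc⟩ := exists_isCycle_subset hne fun _ => hbal.exists_src_eq
    obtain ⟨χ, hχ⟩ := exists_dual_eq_reverse hcard hc.isBalanced
    have hdiff : diff χ ψ = diff φ ψ \ c := by
      ext e
      simp only [Set.mem_sdiff, diff, Set.mem_ofPred_eq, hχ]
      by_cases he : e ∈ c
      · simp only [reverse_tgt_of_mem he, dual_tgt_eq_src_of_mem_diff hcard (hsub he),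
          ne_eq, not_true, he, and_false]
      · simp only [reverse_tgt_of_notMem he, he, not_false_iff, and_true]
    have hlt : (diff χ ψ).ncard < n := by
      have hpos := (Set.ncard_pos c.toFinite).2 hc.nonempty
      have hsum := Set.ncard_sdiff_add_ncard_of_subset hsub
      rw [hdiff]
      omega
    exact .head ⟨c, (isDirectedCycle_iff hcard).2
        ⟨hc, fun e he => src_ne_tgt_of_mem_diff hcard (hsub he)⟩,
      reverses_of_dual_eq_reverse hcard hχ⟩ (ih _ hlt χ rfl)

theorem bijective_diff (φ : G.EdgeInjective) : Function.Bijective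
    fun ψ : {ψ // ψ ≠ φ} => (⟨diff φ ψ, (isGenDirectedCycle_iff hcard).2
      ⟨Set.nonempty_iff_ne_empty.2 fun h => ψ.2 (diff_eq_empty_iff.1 h).symm,
        isBalanced_of_dual_eq_reverse hcard (dual_eq_reverse_diff hcard φ ψ),
        fun _ => src_ne_tgt_of_mem_diff hcard⟩⟩ : {C // IsGenDirectedCycle φ C}) := by
  constructor
  · intro ψ χ h
    refine Subtype.ext (eq_of_dual_tgt_eq fun e => ?_)
    have hdiff : diff φ ψ = diff φ χ := congrArg Subtype.val h
    rw [dual_eq_reverse_diff hcard φ ψ, hdiff, ← dual_eq_reverse_diff hcard φ χ]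
  · rintro ⟨C, hC⟩
    obtain ⟨hne, hbal, hloop⟩ := (isGenDirectedCycle_iff hcard).1 hC
    obtain ⟨ψ, hψ⟩ := exists_dual_eq_reverse hcard hbal
    have hdiff := diff_eq_of_dual_eq_reverse hψ hloop
    exact ⟨⟨ψ, fun h => hne.ne_empty (hdiff ▸ diff_eq_empty_iff.2 h.symm)⟩, Subtype.ext hdiff⟩

theorem card_eq_card_isGenDirectedCycle_add_one (φ : G.EdgeInjective) :
    Nat.card G.EdgeInjective = Nat.card {C : Set G.Edge // IsGenDirectedCycle φ C} + 1 := by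
  classical
  rw [← Nat.card_congr (Equiv.optionSubtypeNe φ), Finite.card_option,
    Nat.card_eq_of_bijective _ (bijective_diff hcard φ)]

end Card

/-! ### Height functions -/

open Classical in
/-- The indicator of `φ` directing the edge of the dart `d` to the face on the left of `d`. -/
noncomputable def into (φ : G.EdgeInjective) (d : D) : ℤ :=
  if φ.dual.tgt (G.edge d) = G.left d then 1 else 0

theorem into_of_eq_left (h : φ.dual.tgt (G.edge d) = G.left d) : φ.into d = 1 := if_pos h

theorem into_of_ne_left (h : φ.dual.tgt (G.edge d) ≠ G.left d) : φ.into d = 0 := if_neg h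

theorem into_le_one (φ : G.EdgeInjective) (d : D) : φ.into d ≤ 1 := by
  rw [into]
  split_ifs <;> decide

/-- `p` is a height function for the difference of the orientations `φ` and `ψ`: it is zero at the
unbounded face, and its increments along the edges with different faces on their sides are the
differences of the indicators. The increments along bridges are not prescribed, since their dual
loops have no direction. -/
structure IsHeight (φ ψ : G.EdgeInjective) (p : G.Vertex → ℤ) : Prop where
  into_sub_into : ∀ d, G.left d ≠ G.right d →
    φ.into d - ψ.into d = p (G.head d) - p (G.tail d)
  eq_zero : ∀ v, ¬ Interior v → p v = 0

theorem IsHeight.neg {p : G.Vertex → ℤ} (hp : IsHeight φ ψ p) : IsHeight ψ φ (-p) where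
  into_sub_into d hd := by
    rw [← neg_sub, hp.into_sub_into d hd, Pi.neg_apply, Pi.neg_apply, neg_sub, sub_neg_eq_add,
      neg_add_eq_sub]
  eq_zero v hv := by rw [Pi.neg_apply, hp.eq_zero v hv, neg_zero]

section Card

variable [Finite D] (hcard : Nat.card G.Edge = 3 * Nat.card G.BoundedFace)

include hcard

theorem dual_tgt_edge_of_into_eq (h : φ.into d = ψ.into d) :
    φ.dual.tgt (G.edge d) = ψ.dual.tgt (G.edge d) := by
  have tgt_eq (χ : G.EdgeInjective) :
      χ.dual.tgt (G.edge d) = if χ.into d = 1 then G.left d else G.right d := by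
    by_cases hl : χ.dual.tgt (G.edge d) = G.left d
    · rw [into_of_eq_left hl, if_pos rfl, hl]
    · rw [into_of_ne_left hl, if_neg zero_ne_one]
      exact (dual_tgt_edge hcard χ d).resolve_left hl
  rw [tgt_eq, tgt_eq, h]

theorem IsHeight.eq_of_eq_zero (h : IsHeight φ ψ 0) : φ = ψ := by
  refine eq_of_dual_tgt_eq fun e => ?_
  obtain ⟨d, rfl⟩ := edge_surjective e
  by_cases hd : G.left d = G.right d
  · have tgt_eq (χ : G.EdgeInjective) : χ.dual.tgt (G.edge d) = G.left d :=
      (dual_tgt_edge hcard χ d).elim id fun h => h.trans hd.symm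
    rw [tgt_eq, tgt_eq]
  · exact dual_tgt_edge_of_into_eq hcard (sub_eq_zero.1 (h.into_sub_into d hd))

theorem into_sub_into_rev (φ ψ : G.EdgeInjective) (d : D) :
    φ.into (G.rev d) - ψ.into (G.rev d) = -(φ.into d - ψ.into d) := by
  by_cases hd : G.left d = G.right d
  · have into_eq_one (χ : G.EdgeInjective) {d : D} (hd : G.left d = G.right d) : χ.into d = 1 :=
      into_of_eq_left ((dual_tgt_edge hcard χ d).elim id fun h => h.trans hd.symm)
    have hd' : G.left (G.rev d) = G.right (G.rev d) := by rw [left_rev, right_rev, hd]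
    simp only [into_eq_one _ hd, into_eq_one _ hd', sub_self, neg_zero]
  · have into_rev (χ : G.EdgeInjective) : χ.into (G.rev d) = 1 - χ.into d := by
      obtain h | h := dual_tgt_edge hcard χ d
      · rw [into_of_eq_left h, into_of_ne_left (by rwa [edge_rev, left_rev, h]), sub_self]
      · rw [into_of_eq_left (by rwa [edge_rev]), into_of_ne_left (h.trans_ne (Ne.symm hd)),
          sub_zero]
    rw [into_rev, into_rev, sub_sub_sub_cancel_left, neg_sub]

theorem apply_dual_tgt_edge {R : Type*} [CommRing R] (φ : G.EdgeInjective) (g : G.Face → R)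
    (d : D) : g (φ.dual.tgt (G.edge d)) =
      g (G.right d) + (g (G.left d) - g (G.right d)) * φ.into d := by
  by_cases hl : φ.dual.tgt (G.edge d) = G.left d
  · rw [into_of_eq_left hl, hl, Int.cast_one, mul_one, add_sub_cancel]
  · rw [into_of_ne_left hl, (dual_tgt_edge hcard φ d).resolve_left hl, Int.cast_zero, mul_zero,
      add_zero]

theorem sum_dual_tgt_eq [Fintype G.Edge] {M : Type*} [AddCommMonoid M] (φ ψ : G.EdgeInjective)
    (g : G.Face → M) : ∑ e, g (φ.dual.tgt e) = ∑ e, g (ψ.dual.tgt e) := by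
  classical
  have := Fintype.ofFinite G.Face
  rw [← Finset.sum_fiberwise' Finset.univ φ.dual.tgt g,
    ← Finset.sum_fiberwise' Finset.univ ψ.dual.tgt g]
  refine Finset.sum_congr rfl fun F _ => ?_
  rw [Finset.sum_const, Finset.sum_const, ← Set.ncard_coe_finset, ← Set.ncard_coe_finset,
    Finset.coe_filter_univ, Finset.coe_filter_univ, ncard_dual_tgt_eq hcard φ ψ F]

theorem sum_mul_into_sub_into [Fintype D] (φ ψ : G.EdgeInjective) (g : G.Face → ℚ) :
    ∑ d, g (G.left d) * (φ.into d - ψ.into d : ℤ) = 0 := by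
  have := Fintype.ofFinite G.Edge
  have hsum : ∑ d, g (G.left d) * ((φ.into d - ψ.into d : ℤ) : ℚ) +
      ∑ d, g (G.left d) * ((φ.into d - ψ.into d : ℤ) : ℚ) = 0 := by
    calc
      _ = ∑ d, (g (G.left d) * ((φ.into d - ψ.into d : ℤ) : ℚ) +
            g (G.right d) * ((φ.into (G.rev d) - ψ.into (G.rev d) : ℤ) : ℚ)) := by
        rw [Finset.sum_add_distrib]
        congr 1
        exact (Equiv.sum_comp G.rev _).symm
      _ = ∑ d, (g (φ.dual.tgt (G.edge d)) - g (ψ.dual.tgt (G.edge d))) :=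
        Finset.sum_congr rfl fun d _ => by
          rw [into_sub_into_rev hcard, apply_dual_tgt_edge hcard φ g,
            apply_dual_tgt_edge hcard ψ g]
          push_cast
          ring
      _ = 0 := by
        rw [Finset.sum_sub_distrib, sum_edge fun e => g (φ.dual.tgt e),
          sum_edge fun e => g (ψ.dual.tgt e), sum_dual_tgt_eq hcard φ ψ, sub_self]
  exact add_self_eq_zero.1 hsum

theorem exists_isHeight (φ ψ : G.EdgeInjective) : ∃ p, IsHeight φ ψ p := by
  have := Fintype.ofFinite D
  obtain ⟨p, hp⟩ := exists_eq_head_sub_tail (into_sub_into_rev hcard φ ψ)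
    (sum_mul_into_sub_into hcard φ ψ)
  obtain ⟨a, ha⟩ := left_surjective G.outer
  have const_on_outer (d : D) (hd : G.left d = G.outer) : p (G.head d) = p (G.tail d) := by
    rw [← sub_eq_zero, ← hp, into_of_ne_left (hd.symm ▸ dual_tgt_ne_outer hcard φ _),
      into_of_ne_left (hd.symm ▸ dual_tgt_ne_outer hcard ψ _), sub_self]
  refine ⟨fun v => p v - p (G.tail a), fun d _ => ?_, fun v hv => ?_⟩
  · rw [hp, sub_sub_sub_cancel_right]
  · rw [Interior] at hv
    push Not at hv
    obtain ⟨d, rfl, hd⟩ := hv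
    rw [tail_eq_of_forall_left_eq const_on_outer hd ha, sub_self]

end Card

/-! ### Clockwise vertices -/

/-- All edges at `v` are crossed from left to right as seen from `v`, so that the face of the dual
graph around `v` is bounded by a clockwise walk. -/
def IsClockwise (φ : G.EdgeInjective) (v : G.Vertex) : Prop :=
  ∀ d, G.tail d = v → φ.dual.tgt (G.edge d) = G.right d

theorem exists_mem_edgesOf_forall_notMem [Finite D] (φ : G.EdgeInjective)
    (hcon : G.NoProperContractible) {S : Set G.BoundedFace} (hne : S.Nonempty)
    (huniv : S ≠ Set.univ) : ∃ e ∈ G.edgesOf S, ∀ F ∈ S, e ∉ φ.1 F := by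
  classical
  by_contra! hsub
  have hle : (G.edgesOf S).ncard ≤ (S.toFinite.toFinset.biUnion φ.1).card := by
    rw [← Set.ncard_coe_finset]
    refine Set.ncard_le_ncard fun e he => ?_
    obtain ⟨F, hF, heF⟩ := hsub e he
    exact Finset.mem_biUnion.2 ⟨F, S.toFinite.mem_toFinset.2 hF, heF⟩
  have hmul := Finset.card_biUnion_le_card_mul S.toFinite.toFinset φ.1 3 fun F _ => (φ.2.1 F).le
  have hlt := hcon.three_mul_ncard_lt hne huniv
  rw [Set.ncard_eq_toFinset_card S] at hlt
  omega

section Card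

variable [Finite D] (hcard : Nat.card G.Edge = 3 * Nat.card G.BoundedFace)

include hcard

/-- Otherwise the faces around which the cycle winds most often would be left by none of the edges
on their boundary. -/
theorem not_isCycle_dartGraph (hcon : G.NoProperContractible) {X : Set D}
    (hX : ∀ d ∈ X, φ.dual.tgt (G.edge d) ≠ G.right d) (hout : ∀ d ∈ X, G.right d ≠ G.outer) :
    ¬ G.dartGraph.IsCycle X := by
  intro hcycle
  obtain ⟨g, hg_left, hg_le⟩ := exists_windingNumber hcycle fun d hd hd' =>
    (dual_tgt_edge hcard φ d).elim (fun h => hX _ hd' (by rw [edge_rev, right_rev, h])) (hX d hd)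
  obtain ⟨b, hb⟩ := hcycle.nonempty
  have hleft : G.left b ≠ G.outer := by
    rw [← (dual_tgt_edge hcard φ b).resolve_right (hX b hb)]
    exact dual_tgt_ne_outer hcard φ _
  have : Nonempty G.BoundedFace := ⟨⟨_, hleft⟩⟩
  obtain ⟨F₀, hF₀⟩ := Finite.exists_max fun F : G.BoundedFace => g F.1
  let S : Set G.BoundedFace := {F | g F.1 = g F₀.1}
  have huniv : S ≠ Set.univ := fun h => by
    have hright : g (G.right b) = g F₀.1 := Set.eq_univ_iff_forall.1 h ⟨_, hout b hb⟩
    linarith [hF₀ ⟨_, hleft⟩, hg_left b hb]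
  have hne : S.Nonempty := ⟨F₀, rfl⟩
  obtain ⟨_, ⟨F, hF, d, rfl, hd⟩, hnot⟩ := exists_mem_edgesOf_forall_notMem φ hcon hne huniv
  have htgt : φ.dual.tgt (G.edge d) = G.right d :=
    (dual_tgt_edge hcard φ d).resolve_left fun h => hnot F hF (dual_tgt_eq_iff.1 (h.trans hd))
  have hright : G.right d ≠ G.outer := htgt ▸ dual_tgt_ne_outer hcard φ _
  have hright_notMem : ⟨_, hright⟩ ∉ S := fun h => hnot _ h (dual_tgt_eq_iff.1 htgt)
  have hlt : g (G.right d) < g (G.left d) := by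
    rw [hd, show g F.1 = g F₀.1 from hF]
    exact (hF₀ ⟨_, hright⟩).lt_of_ne hright_notMem
  by_cases hdX : d ∈ X
  · exact hX d hdX htgt
  · exact (hg_le d hdX).not_gt hlt

theorem IsHeight.exists_isClockwise (hcon : G.NoProperContractible) {p : G.Vertex → ℤ}
    (hp : IsHeight φ ψ p) {w : G.Vertex} (hw : 0 < p w) :
    ∃ v, 0 < p v ∧ IsClockwise φ v := by
  have : Nonempty G.Vertex := ⟨w⟩
  obtain ⟨v₀, hv₀⟩ := Finite.exists_max p
  have hpos {v : G.Vertex} (hv : p v = p v₀) : 0 < p v := hv ▸ hw.trans_le (hv₀ w)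
  by_contra! hcw
  let X : Set D := {d | p (G.tail d) = p v₀ ∧ φ.dual.tgt (G.edge d) ≠ G.right d}
  have exists_mem {v : G.Vertex} (hv : p v = p v₀) : ∃ d ∈ X, G.tail d = v := by
    have hcw := hcw v (hpos hv)
    rw [IsClockwise] at hcw
    push Not at hcw
    obtain ⟨d, rfl, hd⟩ := hcw
    exact ⟨d, ⟨hv, hd⟩, rfl⟩
  have head_eq {d : D} (hd : d ∈ X) : p (G.head d) = p v₀ := by
    have htgt := (dual_tgt_edge hcard φ d).resolve_right hd.2
    have hinc := hp.into_sub_into d (htgt ▸ hd.2)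
    rw [into_of_eq_left htgt, hd.1] at hinc
    linarith [hv₀ (G.head d), into_le_one ψ d]
  obtain ⟨b, hb, -⟩ := exists_mem (v := v₀) rfl
  obtain ⟨c, hcX, hc⟩ := exists_isCycle_subset (Γ := G.dartGraph) ⟨b, hb⟩
    fun d hd => exists_mem (head_eq hd)
  refine not_isCycle_dartGraph hcard hcon (fun d hd => (hcX hd).2) (fun d hd => ?_) hc
  have hinterior : Interior (G.tail d) := by
    by_contra hext
    exact (hpos (hcX hd).1).ne' (hp.eq_zero _ hext)
  rw [← left_next_symm]
  exact hinterior _ (tail_next_symm d)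

end Card

/-! ### Flipping face cycles -/

theorem IsClockwise.head_ne [Finite D] {v : G.Vertex} (hv : φ.IsClockwise v) (hd : G.tail d = v) :
    G.head d ≠ v := fun hhead => by
  have hrev := hv (G.rev d) hhead
  rw [edge_rev, right_rev, hv d hd] at hrev
  exact head_ne_tail_of_left_eq_right hrev.symm (hhead.trans hd.symm)

theorem IsClockwise.isBalanced_faceCycle [Finite D] {v : G.Vertex} (hv : φ.IsClockwise v) :
    φ.dual.IsBalanced (faceCycle v) := by
  let e : {d // G.tail d = v} → G.Edge := fun d => G.edge d
  have he : Function.Injective e := fun d d' h => by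
    obtain h | h := edge_eq_iff.1 h
    · exact Subtype.ext h
    · exact absurd ((congrArg G.tail h).symm.trans d.2) (hv.head_ne d'.2)
  let σ : Equiv.Perm {d // G.tail d = v} :=
    Equiv.Perm.subtypePerm G.next.symm fun d => by rw [tail_next_symm]
  have hrange : faceCycle v = Set.range e := by
    ext
    simp only [faceCycle, e, Set.mem_ofPred_eq, Set.mem_range, Subtype.exists, exists_prop]
  rw [hrange]
  refine isBalanced_range he σ fun d => ?_
  rw [dual_src_edge_of_eq_right (hv _ (σ d).2), hv _ d.2]
  exact left_next_symm d.1

theorem IsClockwise.isDirectedFaceCycle {v : G.Vertex} (hv : φ.IsClockwise v)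
    (hinterior : Interior v) : IsDirectedFaceCycle φ v := by
  refine ⟨hinterior, Or.inr fun d hd => ⟨hinterior d hd, ?_, ?_⟩⟩
  · rw [← left_next_symm]
    exact hinterior _ ((tail_next_symm d).trans hd)
  · exact arrow_iff.2 ⟨hv d hd, Or.inl (dual_src_edge_of_eq_right (hv d hd))⟩

theorem IsClockwise.into_of_dual_eq_reverse [Finite D] [DecidableEq G.Vertex] {v : G.Vertex}
    (hv : φ.IsClockwise v) (hψ : ψ.dual = φ.dual.reverse (faceCycle v))
    (hd : G.left d ≠ G.right d) :
    ψ.into d = φ.into d + (if G.tail d = v then 1 else 0) - (if G.head d = v then 1 else 0) := by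
  by_cases htail : G.tail d = v
  · have hmem : G.edge d ∈ faceCycle v := ⟨d, htail, rfl⟩
    have hφ := hv d htail
    rw [if_pos htail, if_neg (hv.head_ne htail), into_of_ne_left (hφ.trans_ne hd.symm),
      into_of_eq_left, zero_add, sub_zero]
    rw [hψ, reverse_tgt_of_mem hmem, dual_src_edge_of_eq_right hφ]
  by_cases hhead : G.head d = v
  · have hmem : G.edge d ∈ faceCycle v := ⟨G.rev d, hhead, edge_rev d⟩
    have hφ : φ.dual.tgt (G.edge d) = G.left d := by
      rw [← edge_rev, hv _ hhead, right_rev]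
    rw [if_neg htail, if_pos hhead, into_of_eq_left hφ, into_of_ne_left, add_zero, sub_self]
    rw [hψ, reverse_tgt_of_mem hmem, dual_src_edge hφ]
    exact hd.symm
  · have hnotMem : G.edge d ∉ faceCycle v := by
      rintro ⟨d', hd', hedge⟩
      obtain rfl | rfl := edge_eq_iff.1 hedge
      · exact htail hd'
      · exact hhead hd'
    rw [if_neg htail, if_neg hhead, add_zero, sub_zero, into, into, hψ,
      reverse_tgt_of_notMem hnotMem]

theorem IsHeight.sub_single [Finite D] [DecidableEq G.Vertex] {χ : G.EdgeInjective}
    {p : G.Vertex → ℤ} {v : G.Vertex} (hp : IsHeight φ ψ p) (hv : φ.IsClockwise v)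
    (hinterior : Interior v) (hχ : χ.dual = φ.dual.reverse (faceCycle v)) :
    IsHeight χ ψ (p - Pi.single v 1) where
  into_sub_into d hd := by
    rw [hv.into_of_dual_eq_reverse hχ hd]
    simp only [Pi.sub_apply, Pi.single_apply]
    linarith [hp.into_sub_into d hd]
  eq_zero w hw := by
    have hne : w ≠ v := fun h => hw (h ▸ hinterior)
    rw [Pi.sub_apply, hp.eq_zero w hw, Pi.single_eq_of_ne hne, sub_zero]

section Card

variable [Finite D] (hcard : Nat.card G.Edge = 3 * Nat.card G.BoundedFace)

include hcard

theorem flipGraph_reachable_of_dual_eq_reverse {v : G.Vertex} (hv : φ.IsClockwise v)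
    (hinterior : Interior v) (hψ : ψ.dual = φ.dual.reverse (faceCycle v)) :
    G.flipGraph.Reachable φ ψ := by
  obtain rfl | hne := eq_or_ne φ ψ
  · rfl
  · exact SimpleGraph.Adj.reachable <| (SimpleGraph.fromRel_adj _ _ _).2
      ⟨hne, Or.inl ⟨v, hv.isDirectedFaceCycle hinterior, reverses_of_dual_eq_reverse hcard hψ⟩⟩

theorem IsHeight.flipGraph_reachable (hcon : G.NoProperContractible) {p : G.Vertex → ℤ}
    (hp : IsHeight φ ψ p) : G.flipGraph.Reachable φ ψ := by
  classical
  have := Fintype.ofFinite G.Vertex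
  induction hn : ∑ v, (p v).natAbs using Nat.strong_induction_on generalizing φ ψ p with
  | h n ih =>
    obtain rfl | hzero := eq_or_ne p 0
    · rw [hp.eq_of_eq_zero hcard]
    wlog hpos : ∃ w, 0 < p w generalizing φ ψ p
    · refine (this hp.neg (by simpa only [Pi.neg_apply, Int.natAbs_neg] using hn)
        (neg_ne_zero.2 hzero) ?_).symm
      obtain ⟨w, hw⟩ := Function.ne_iff.1 hzero
      push Not at hpos
      exact ⟨w, neg_pos.2 ((hpos w).lt_of_ne hw)⟩
    obtain ⟨w, hw⟩ := hpos
    obtain ⟨v, hvpos, hv⟩ := hp.exists_isClockwise hcard hcon hw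
    have hinterior : Interior v := by
      by_contra hext
      exact hvpos.ne' (hp.eq_zero v hext)
    obtain ⟨χ, hχ⟩ := exists_dual_eq_reverse hcard hv.isBalanced_faceCycle
    exact (flipGraph_reachable_of_dual_eq_reverse hcard hv hinterior hχ).trans
      (ih _ (hn ▸ sum_natAbs_sub_single_lt hvpos) (hp.sub_single hv hinterior hχ) rfl)

theorem flipGraph_preconnected (hcon : G.NoProperContractible) : G.flipGraph.Preconnected :=
  fun φ ψ => (exists_isHeight hcard φ ψ).elim fun _ hp => hp.flipGraph_reachable hcard hcon

end Card

end EdgeInjective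

end PlaneGraph

theorem mainTheorem11 {D : Type*} [Finite D] (G : PlaneGraph D)
    (hleaf : G.NoLeaves)
    (hcard : Nat.card G.Edge = 3 * Nat.card G.BoundedFace)
    (hcon : G.NoProperContractible) :
    -- reversing directed cycles
    (∀ φ φ' : G.EdgeInjective,
      Relation.ReflTransGen
        (fun ψ ψ' : G.EdgeInjective =>
          ∃ C : Set G.Edge, PlaneGraph.IsDirectedCycle ψ C ∧ PlaneGraph.Reverses C ψ ψ')
        φ' φ) ∧
    -- reversing directed face cycles
    G.flipGraph.Connected ∧
    -- counting
    (∀ φ : G.EdgeInjective,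
      Nat.card G.EdgeInjective =
        Nat.card {C : Set G.Edge // PlaneGraph.IsGenDirectedCycle φ C} + 1) ∧
    (∀ φ φ' : G.EdgeInjective,
      Nat.card {C : Set G.Edge // PlaneGraph.IsGenDirectedCycle φ C} =
        Nat.card {C : Set G.Edge // PlaneGraph.IsGenDirectedCycle φ' C}) := by
  have hcount := PlaneGraph.EdgeInjective.card_eq_card_isGenDirectedCycle_add_one hcard
  have := PlaneGraph.nonempty_edgeInjective hleaf hcard hcon
  have hpre := PlaneGraph.EdgeInjective.flipGraph_preconnected hcard hcon
  refine ⟨fun φ φ' => ?_, ⟨hpre⟩, hcount, fun φ φ' => ?_⟩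
  · exact PlaneGraph.EdgeInjective.reflTransGen_reverses_isDirectedCycle hcard φ' φ
  · exact Nat.add_right_cancel ((hcount φ).symm.trans (hcount φ'))
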